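/- Fix a field $k$. All categories are small and $k$-linear, and functors between them are $k$-linear. A DG category $\mathscr{B}$ is a category whose morphism spaces are complexes of $k$-vector spaces such that the compositions $\mathrm{Hom}(A_1,A_2)\otimes\mathrm{Hom}(A_2,A_3)\to\mathrm{Hom}(A_1,A_3)$ are morphisms of complexes and the identities are closed of degree $0$. Its homotopy category $H^0(\mathscr{B})$ has the same objects and morphism spaces $H^0(\mathrm{Hom}_{\mathscr{B}}(A_1,A_2))$. A DG functor is a quasi-equivalence if it induces quasi-isomorphisms on all morphism complexes and an equivalence on homotopy categories. A quasi-functor is a morphism in the localization of the category of small DG categories with respect to quasi-equivalences; it induces a functor $H^0(\mathcal{F})$ on homotopy categories, well defined up to isomorphism. A DG category $\mathscr{B}$ is pre-triangulated if in its pre-triangulated hull $\mathscr{B}^{\mathrm{pre\text{-}tr}}$ (the DG category of one-sided twisted complexes over $\mathscr{B}$) all shifts $B[n]$, $n\in\mathbb{Z}$, of objects of $\mathscr{B}$ and all cones of closed degree $0$ morphisms of $\mathscr{B}$ are homotopy equivalent to objects of $\mathscr{B}$; then $H^0(\mathscr{B})$ is naturally a triangulated category. A DG enhancement of a triangulated category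 $\mathscr{T}$ is a pair $(\mathscr{B},e)$ where $\mathscr{B}$ is a pre-triangulated DG category and $e\colon H^0(\mathscr{B})\to\mathscr{T}$ is an equivalence of triangulated categories. The category $\mathscr{T}$ has a strongly unique DG enhancement if for any two DG enhancements $(\mathscr{B},e)$ and $(\mathscr{B}',e')$ of $\mathscr{T}$ there is a quasi-functor $\mathcal{F}\colon\mathscr{B}\to\mathscr{B}'$ such that $H^0(\mathcal{F})$ is an equivalence of triangulated categories and the functors $e$ and $e'\circ H^0(\mathcal{F})$ are isomorphic. **Proposition.** Let $(\mathscr{B}_1,e_1)$ and $(\mathscr{B}_2,e_2)$ be DG enhancements of a triangulated category $\mathscr{T}$. Let $T\in\mathrm{Ob}(\mathscr{T})$, $B_1\in\mathrm{Ob}(\mathscr{B}_1)$ and $B_2\in\mathrm{Ob}(\mathscr{B}_2)$ be such that $T$, $e_1(B_1)$ and $e_2(B_2)$ are isomorphic in $\mathscr{T}$. Assume that $\mathscr{T}$ has a strongly unique DG enhancement. Then $\mathrm{Hom}_{\mathscr{B}_1}(B_1,B_1)$ and $\mathrm{Hom}_{\mathscr{B}_2}(B_2,B_2)$ are quasi-isomorphic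 DG algebras, that is, they are connected by a finite zigzag of quasi-isomorphisms of DG algebras. -/

import Mathlib

open CategoryTheory CategoryTheory.Limits

universe w u

/-- A DG `k`-module: a cochain complex of `k`-vector spaces, with homogeneous components `X i`
and differential `d` of degree `1`. -/
structure DGModule (k : Type w) [Field k] where
  X : ℤ → Type u
  [addCommGroup : ∀ i, AddCommGroup (X i)]
  [module : ∀ i, Module k (X i)]
  d : ∀ i j : ℤ, i + 1 = j → X i →ₗ[k] X j
  d_d : ∀ (i j l : ℤ) (hij : i + 1 = j) (hjl : j + 1 = l) (x : X i), d j l hjl (d i j hij x) = 0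

attribute [instance] DGModule.addCommGroup DGModule.module

namespace DGModule

variable {k : Type w} [Field k]

/-- The closed elements of degree `n`. -/
def cocycles (M : DGModule.{w, u} k) (n : ℤ) : Submodule k (M.X n) :=
  LinearMap.ker (M.d n (n + 1) rfl)

/-- The exact elements of degree `n`, as a subspace of the closed ones. -/
def boundaries (M : DGModule.{w, u} k) (n : ℤ) : Submodule k (M.cocycles n) :=
  (LinearMap.range (M.d (n - 1) n (by omega))).comap (M.cocycles n).subtype

/-- The cohomology `Hⁿ(M)`. -/
abbrev H (M : DGModule.{w, u} k) (n : ℤ) : Type u := M.cocycles n ⧸ M.boundaries n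

/-- A morphism of DG modules: a family of linear maps of degree `0` commuting with `d`. -/
structure Hom (M N : DGModule.{w, u} k) where
  f : ∀ i : ℤ, M.X i →ₗ[k] N.X i
  comm : ∀ (i j : ℤ) (h : i + 1 = j) (x : M.X i), f j (M.d i j h x) = N.d i j h (f i x)

namespace Hom

/-- The map induced by a morphism of DG modules on closed elements. -/
def mapCocycles {M N : DGModule.{w, u} k} (φ : Hom M N) (n : ℤ) :
    M.cocycles n →ₗ[k] N.cocycles n :=
  (φ.f n).restrict fun x hx => by
    have hx' : M.d n (n + 1) rfl x = 0 := hx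
    change N.d n (n + 1) rfl (φ.f n x) = 0
    rw [← φ.comm, hx', map_zero]

/-- The map induced by a morphism of DG modules on cohomology. -/
def mapH {M N : DGModule.{w, u} k} (φ : Hom M N) (n : ℤ) : M.H n →ₗ[k] N.H n :=
  Submodule.mapQ _ _ (φ.mapCocycles n) (by
    rintro ⟨x, hx⟩ ⟨y, hy⟩
    exact ⟨φ.f _ y, by rw [← φ.comm, hy]; rfl⟩)

/-- A quasi-isomorphism: a morphism inducing bijections on cohomology in all degrees. -/
def IsQuasiIso {M N : DGModule.{w, u} k} (φ : Hom M N) : Prop :=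
  ∀ n : ℤ, Function.Bijective (φ.mapH n)

end Hom

end DGModule

/-- A DG algebra over `k`: a DG module with an associative unital multiplication which is a
morphism of DG modules, that is, which satisfies the graded Leibniz rule. The multiplication
`X i × X j → X n` is indexed by the degrees `i`, `j` and by `n = i + j`. -/
structure DGAlgebra (k : Type w) [Field k] extends DGModule.{w, u} k where
  one : X 0
  mul : ∀ i j n : ℤ, i + j = n → X i →ₗ[k] X j →ₗ[k] X n
  d_one : d 0 1 (by norm_num) one = 0
  leibniz : ∀ (i j n i' j' n' : ℤ) (h : i + j = n) (hi : i + 1 = i') (hj : j + 1 = j')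
    (hn : n + 1 = n') (x : X i) (y : X j),
    d n n' hn (mul i j n h x y) =
      mul i' j n' (by omega) (d i i' hi x) y +
        (i.negOnePow : ℤ) • mul i j' n' (by omega) x (d j j' hj y)
  one_mul : ∀ (i : ℤ) (x : X i), mul 0 i i (by omega) one x = x
  mul_one : ∀ (i : ℤ) (x : X i), mul i 0 i (by omega) x one = x
  mul_assoc : ∀ (i j l ij jl n : ℤ) (hij : i + j = ij) (hjl : j + l = jl) (h : ij + l = n)
    (x : X i) (y : X j) (z : X l),
    mul ij l n h (mul i j ij hij x y) z = mul i jl n (by omega) x (mul j l jl hjl y z)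

namespace DGAlgebra

variable {k : Type w} [Field k]

/-- A morphism of DG algebras. -/
structure Hom (A B : DGAlgebra.{w, u} k) extends DGModule.Hom A.toDGModule B.toDGModule where
  map_one : f 0 A.one = B.one
  map_mul : ∀ (i j n : ℤ) (h : i + j = n) (x : A.X i) (y : A.X j),
    f n (A.mul i j n h x y) = B.mul i j n h (f i x) (f j y)

/-- Two DG algebras are quasi-isomorphic if they are connected by a finite zigzag of
morphisms of DG algebras, each of which is a quasi-isomorphism. -/
def QuasiIsomorphic (A B : DGAlgebra.{w, u} k) : Prop :=
  Relation.EqvGen (fun A B : DGAlgebra.{w, u} k => ∃ φ : Hom A B, φ.toHom.IsQuasiIso) A B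

end DGAlgebra

/-- A small DG category over `k`. The composition `comp i j n h f g` of `f : X ⟶ Y` of degree `i`
with `g : Y ⟶ Z` of degree `j`, of degree `n = i + j`, is in diagrammatic order; the Leibniz rule
says that `Hom X Y ⊗ Hom Y Z → Hom X Z` is a morphism of DG modules. -/
structure DGCategory (k : Type w) [Field k] where
  Obj : Type u
  Hom : Obj → Obj → DGModule.{w, u} k
  id : ∀ X : Obj, (Hom X X).X 0
  comp : ∀ {X Y Z : Obj} (i j n : ℤ), i + j = n →
    (Hom X Y).X i →ₗ[k] (Hom Y Z).X j →ₗ[k] (Hom X Z).X n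
  d_id : ∀ X : Obj, (Hom X X).d 0 1 (by norm_num) (id X) = 0
  leibniz : ∀ {X Y Z : Obj} (i j n i' j' n' : ℤ) (h : i + j = n) (hi : i + 1 = i')
    (hj : j + 1 = j') (hn : n + 1 = n') (f : (Hom X Y).X i) (g : (Hom Y Z).X j),
    (Hom X Z).d n n' hn (comp i j n h f g) =
      comp i' j n' (by omega) ((Hom X Y).d i i' hi f) g +
        (i.negOnePow : ℤ) • comp i j' n' (by omega) f ((Hom Y Z).d j j' hj g)
  id_comp : ∀ {X Y : Obj} (i : ℤ) (f : (Hom X Y).X i), comp 0 i i (by omega) (id X) f = f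
  comp_id : ∀ {X Y : Obj} (i : ℤ) (f : (Hom X Y).X i), comp i 0 i (by omega) f (id Y) = f
  assoc : ∀ {X Y Z W : Obj} (i j l ij jl n : ℤ) (hij : i + j = ij) (hjl : j + l = jl)
    (h : ij + l = n) (f : (Hom X Y).X i) (g : (Hom Y Z).X j) (e : (Hom Z W).X l),
    comp ij l n h (comp i j ij hij f g) e = comp i jl n (by omega) f (comp j l jl hjl g e)

namespace DGCategory

variable {k : Type w} [Field k]

/-- The endomorphism DG algebra `Hom(X, X)` of an object of a DG category. -/
def endAlgebra (B : DGCategory.{w, u} k) (X : B.Obj) : DGAlgebra.{w, u} k where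
  toDGModule := B.Hom X X
  one := B.id X
  mul := B.comp
  d_one := B.d_id X
  leibniz := B.leibniz
  one_mul := B.id_comp
  mul_one := B.comp_id
  mul_assoc := B.assoc

/-- Composition of closed morphisms. -/
def compCocycles (B : DGCategory.{w, u} k) {X Y Z : B.Obj} (i j n : ℤ) (h : i + j = n) :
    (B.Hom X Y).cocycles i →ₗ[k] (B.Hom Y Z).cocycles j →ₗ[k] (B.Hom X Z).cocycles n :=
  LinearMap.mk₂ k
    (fun f g => ⟨B.comp i j n h f.1 g.1, by
      have hf : (B.Hom X Y).d i (i + 1) rfl f.1 = 0 := f.2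
      have hg : (B.Hom Y Z).d j (j + 1) rfl g.1 = 0 := g.2
      change (B.Hom X Z).d n (n + 1) rfl _ = 0
      rw [B.leibniz i j n _ _ _ h rfl rfl rfl, hf, hg]
      simp⟩)
    (fun f f' g => Subtype.ext (by simp)) (fun c f g => Subtype.ext (by simp))
    (fun f g g' => Subtype.ext (by simp)) (fun c f g => Subtype.ext (by simp))

/-- Composition `Hⁱ(Hom X Y) × Hʲ(Hom Y Z) → Hⁱ⁺ʲ(Hom X Z)` induced on cohomology. -/
def compH (B : DGCategory.{w, u} k) {X Y Z : B.Obj} (i j n : ℤ) (h : i + j = n) :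
    (B.Hom X Y).H i →ₗ[k] (B.Hom Y Z).H j →ₗ[k] (B.Hom X Z).H n :=
  (Submodule.liftQ _
    (Submodule.liftQ ((B.Hom X Y).boundaries i)
      ((B.compCocycles i j n h).compr₂ (Submodule.mkQ ((B.Hom X Z).boundaries n)))
      (by
        rintro ⟨f, hf⟩ ⟨e, rfl⟩
        refine LinearMap.ext fun ⟨g, hg⟩ => (Submodule.Quotient.mk_eq_zero _).2 ?_
        have hg' : (B.Hom Y Z).d j (j + 1) rfl g = 0 := hg
        refine ⟨B.comp (i - 1) j (n - 1) (by omega) e g, ?_⟩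
        rw [B.leibniz (i - 1) j (n - 1) i (j + 1) n (by omega) (by omega) rfl (by omega), hg']
        simp [compCocycles])).flip
    (by
      rintro ⟨g, hg⟩ ⟨e, rfl⟩
      refine LinearMap.ext fun f => ?_
      obtain ⟨⟨f, hf⟩, rfl⟩ := Submodule.Quotient.mk_surjective _ f
      refine (Submodule.Quotient.mk_eq_zero _).2 ?_
      have hf' : (B.Hom X Y).d i (i + 1) rfl f = 0 := hf
      refine ⟨(i.negOnePow : ℤ) • B.comp i (j - 1) (n - 1) (by omega) f e, ?_⟩
      rw [map_zsmul, B.leibniz i (j - 1) (n - 1) (i + 1) j n (by omega) rfl (by omega) (by omega),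
        hf']
      simp [compCocycles, smul_smul])).flip

/-- The class of the identity in `H⁰(Hom X X)`. -/
def idH (B : DGCategory.{w, u} k) (X : B.Obj) : (B.Hom X X).H 0 :=
  Submodule.Quotient.mk ⟨B.id X, B.d_id X⟩

lemma compH_mk (B : DGCategory.{w, u} k) {X Y Z : B.Obj} (i j n : ℤ) (h : i + j = n)
    (f : (B.Hom X Y).cocycles i) (g : (B.Hom Y Z).cocycles j) :
    B.compH i j n h (Submodule.Quotient.mk f) (Submodule.Quotient.mk g) =
      Submodule.Quotient.mk ⟨B.comp i j n h f.1 g.1, (B.compCocycles i j n h f g).2⟩ := rfl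

lemma idH_comp (B : DGCategory.{w, u} k) {X Y : B.Obj} (i : ℤ) (h : 0 + i = i)
    (f : (B.Hom X Y).H i) : B.compH 0 i i h (B.idH X) f = f := by
  obtain ⟨f, rfl⟩ := Submodule.Quotient.mk_surjective _ f
  exact congrArg Submodule.Quotient.mk (Subtype.ext (B.id_comp i f.1))

lemma comp_idH (B : DGCategory.{w, u} k) {X Y : B.Obj} (i : ℤ) (h : i + 0 = i)
    (f : (B.Hom X Y).H i) : B.compH i 0 i h f (B.idH Y) = f := by
  obtain ⟨f, rfl⟩ := Submodule.Quotient.mk_surjective _ f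
  exact congrArg Submodule.Quotient.mk (Subtype.ext (B.comp_id i f.1))

lemma assocH (B : DGCategory.{w, u} k) {X Y Z W : B.Obj} (i j l ij jl n : ℤ) (hij : i + j = ij)
    (hjl : j + l = jl) (h : ij + l = n) (h' : i + jl = n) (f : (B.Hom X Y).H i)
    (g : (B.Hom Y Z).H j) (e : (B.Hom Z W).H l) :
    B.compH ij l n h (B.compH i j ij hij f g) e =
      B.compH i jl n h' f (B.compH j l jl hjl g e) := by
  obtain ⟨f, rfl⟩ := Submodule.Quotient.mk_surjective _ f
  obtain ⟨g, rfl⟩ := Submodule.Quotient.mk_surjective _ g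
  obtain ⟨e, rfl⟩ := Submodule.Quotient.mk_surjective _ e
  exact congrArg Submodule.Quotient.mk
    (Subtype.ext (B.assoc i j l ij jl n hij hjl h f.1 g.1 e.1))

end DGCategory

/-- The homotopy category `H⁰(B)`: same objects as `B`, morphisms `H⁰(Hom X Y)`. -/
def H0 {k : Type w} [Field k] (B : DGCategory.{w, u} k) : Type u := B.Obj

namespace H0

variable {k : Type w} [Field k]

instance category (B : DGCategory.{w, u} k) : Category.{u} (H0 B) where
  Hom X Y := (DGCategory.Hom B X Y).H 0
  id X := B.idH X
  comp f g := B.compH 0 0 0 (by norm_num) f g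
  id_comp f := B.idH_comp 0 _ f
  comp_id f := B.comp_idH 0 _ f
  assoc f g e := B.assocH 0 0 0 0 0 0 _ _ _ _ f g e

instance preadditive (B : DGCategory.{w, u} k) : Preadditive (H0 B) where
  homGroup X Y := inferInstanceAs (AddCommGroup ((DGCategory.Hom B X Y).H 0))
  add_comp X Y Z f f' g := by
    exact LinearMap.map_add₂ (B.compH 0 0 0 (by norm_num)) f f' g
  comp_add X Y Z f g g' := by
    exact LinearMap.map_add (B.compH (X := X) (Y := Y) (Z := Z) 0 0 0 (by norm_num) f) g g'

instance linear (B : DGCategory.{w, u} k) : Linear k (H0 B) where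
  homModule X Y := inferInstanceAs (Module k ((DGCategory.Hom B X Y).H 0))
  smul_comp X Y Z c f g := by
    exact LinearMap.map_smul₂ (B.compH 0 0 0 (by norm_num)) c f g
  comp_smul X Y Z f c g := by
    exact LinearMap.map_smul (B.compH (X := X) (Y := Y) (Z := Z) 0 0 0 (by norm_num) f) c g

/-- The morphism of `H⁰(B)` represented by a closed morphism of degree `0`. -/
def homMk (B : DGCategory.{w, u} k) {X Y : B.Obj} (f : (B.Hom X Y).X 0)
    (hf : (B.Hom X Y).d 0 1 (by norm_num) f = 0) :
    (show H0 B from X) ⟶ (show H0 B from Y) :=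
  (Submodule.Quotient.mk ⟨f, hf⟩ : (B.Hom X Y).H 0)

end H0

/-- A DG functor. -/
@[ext]
structure DGFunctor {k : Type w} [Field k] (A B : DGCategory.{w, u} k) where
  obj : A.Obj → B.Obj
  map : ∀ X Y : A.Obj, DGModule.Hom (A.Hom X Y) (B.Hom (obj X) (obj Y))
  map_id : ∀ X : A.Obj, (map X X).f 0 (A.id X) = B.id (obj X)
  map_comp : ∀ {X Y Z : A.Obj} (i j n : ℤ) (h : i + j = n) (f : (A.Hom X Y).X i)
    (g : (A.Hom Y Z).X j),
    (map X Z).f n (A.comp i j n h f g) = B.comp i j n h ((map X Y).f i f) ((map Y Z).f j g)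

namespace DGFunctor

variable {k : Type w} [Field k]

/-- The identity DG functor. -/
def id (A : DGCategory.{w, u} k) : DGFunctor A A where
  obj X := X
  map _ _ := { f := fun _ => LinearMap.id, comm := fun _ _ _ _ => rfl }
  map_id _ := rfl
  map_comp _ _ _ _ _ _ := rfl

/-- The composition of DG functors. -/
def comp {A B C : DGCategory.{w, u} k} (F : DGFunctor A B) (G : DGFunctor B C) :
    DGFunctor A C where
  obj X := G.obj (F.obj X)
  map X Y :=
    { f := fun i => (G.map _ _).f i ∘ₗ (F.map X Y).f i
      comm := fun i j h x => by simp [(F.map X Y).comm, (G.map _ _).comm] }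
  map_id X := by simp [F.map_id, G.map_id]
  map_comp i j n h f g := by simp [F.map_comp, G.map_comp]

/-- The functor `H⁰(F) : H⁰(A) ⥤ H⁰(B)` induced by a DG functor `F`. -/
def mapH0 {A B : DGCategory.{w, u} k} (F : DGFunctor A B) : H0 A ⥤ H0 B where
  obj X := F.obj X
  map {X Y} f := (F.map X Y).mapH 0 f
  map_id X := congrArg Submodule.Quotient.mk (Subtype.ext (F.map_id X))
  map_comp {X Y Z} f g := by
    obtain ⟨f, rfl⟩ := Submodule.Quotient.mk_surjective _ f
    obtain ⟨g, rfl⟩ := Submodule.Quotient.mk_surjective _ g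
    exact congrArg Submodule.Quotient.mk (Subtype.ext (F.map_comp 0 0 0 _ f.1 g.1))

/-- A quasi-equivalence: a DG functor that is a quasi-isomorphism on morphism complexes and
induces an equivalence of homotopy categories. -/
def IsQuasiEquivalence {A B : DGCategory.{w, u} k} (F : DGFunctor A B) : Prop :=
  (∀ X Y : A.Obj, (F.map X Y).IsQuasiIso) ∧ F.mapH0.IsEquivalence

end DGFunctor

/-- The category `dgCat` of small DG categories and DG functors. -/
instance DGCategory.instCategory (k : Type w) [Field k] : Category (DGCategory.{w, u} k) where
  Hom A B := DGFunctor A B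
  id A := DGFunctor.id A
  comp F G := F.comp G

/-- The class of quasi-equivalences in `dgCat`. -/
def quasiEquivalences (k : Type w) [Field k] : MorphismProperty (DGCategory.{w, u} k) :=
  fun _ _ F => DGFunctor.IsQuasiEquivalence F

/-- `Hqe`, the localization of `dgCat` with respect to quasi-equivalences. -/
abbrev Hqe (k : Type w) [Field k] := (quasiEquivalences.{w, u} k).Localization

/-- A quasi-functor: a morphism in `Hqe`. -/
abbrev QuasiFunctor {k : Type w} [Field k] (A B : DGCategory.{w, u} k) :=
  (quasiEquivalences k).Q.obj A ⟶ (quasiEquivalences k).Q.obj B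

/-- The category of small categories and isomorphism classes of functors. -/
structure HoCat where
  cat : Cat.{u, u}

namespace HoCat

/-- Functors up to natural isomorphism. -/
abbrev Hom (C D : HoCat.{u}) : Type u :=
  Quotient (isIsomorphicSetoid (C.cat ⥤ D.cat))

/-- The isomorphism class of a functor. -/
def homMk {C D : HoCat.{u}} (F : C.cat ⥤ D.cat) : Hom C D :=
  Quotient.mk (isIsomorphicSetoid (C.cat ⥤ D.cat)) F

/-- Composition of isomorphism classes of functors. -/
def comp {C D E : HoCat.{u}} (F : Hom C D) (G : Hom D E) : Hom C E :=
  Quotient.lift₂ (fun (F : C.cat ⥤ D.cat) (G : D.cat ⥤ E.cat) => homMk (F ⋙ G))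
    (by
      rintro F G F' G' ⟨α⟩ ⟨β⟩
      exact Quotient.sound ⟨Functor.isoWhiskerRight α G ≪≫ Functor.isoWhiskerLeft F' β⟩) F G

instance : Category HoCat.{u} where
  Hom := Hom
  id C := homMk (𝟭 C.cat)
  comp := comp
  id_comp := by rintro C D ⟨F⟩; rfl
  comp_id := by rintro C D ⟨F⟩; rfl
  assoc := by rintro C D E E' ⟨F⟩ ⟨G⟩ ⟨K⟩; rfl

end HoCat

/-- `H⁰` as a functor from `dgCat` to categories and isomorphism classes of functors. -/
def h0Functor (k : Type w) [Field k] : DGCategory.{w, u} k ⥤ HoCat.{u} where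
  obj A := ⟨Cat.of (H0 A)⟩
  map F := HoCat.homMk (C := ⟨Cat.of (H0 _)⟩) (D := ⟨Cat.of (H0 _)⟩) (DGFunctor.mapH0 F)
  map_id A := Quotient.sound ⟨NatIso.ofComponents (fun X => Iso.refl _) (by
    intro X Y f
    obtain ⟨f, rfl⟩ := Submodule.Quotient.mk_surjective _ f
    exact (Category.comp_id _).trans (Category.id_comp _).symm)⟩
  map_comp F G := Quotient.sound ⟨NatIso.ofComponents (fun X => Iso.refl _) (by
    intro X Y f
    obtain ⟨f, rfl⟩ := Submodule.Quotient.mk_surjective _ f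
    exact (Category.comp_id _).trans (Category.id_comp _).symm)⟩

lemma h0Functor_inverts (k : Type w) [Field k] :
    (quasiEquivalences.{w, u} k).IsInvertedBy (h0Functor.{w, u} k) := by
  intro A B F hF
  have : (DGFunctor.mapH0 F).IsEquivalence := hF.2
  exact ⟨⟨HoCat.homMk (C := ⟨Cat.of (H0 _)⟩) (D := ⟨Cat.of (H0 _)⟩) (DGFunctor.mapH0 F).inv,
    Quotient.sound ⟨(DGFunctor.mapH0 F).asEquivalence.unitIso.symm⟩,
    Quotient.sound ⟨(DGFunctor.mapH0 F).asEquivalence.counitIso⟩⟩⟩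

/-- `H⁰` on quasi-functors: the functor on `Hqe` induced by the universal property of the
localization, valued in isomorphism classes of functors. -/
noncomputable def hqeH0Functor (k : Type w) [Field k] : Hqe.{w, u} k ⥤ HoCat.{u} :=
  Localization.Construction.lift (h0Functor k) (h0Functor_inverts k)

/-- `G : H⁰(A) ⥤ H⁰(B)` represents `H⁰(F)` for the quasi-functor `F : A ⟶ B`. -/
def QuasiFunctor.Represents {k : Type w} [Field k] {A B : DGCategory.{w, u} k}
    (F : QuasiFunctor A B) (G : H0 A ⥤ H0 B) : Prop :=
  (hqeH0Functor k).map F = HoCat.homMk (C := ⟨Cat.of (H0 A)⟩) (D := ⟨Cat.of (H0 B)⟩) G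

/-- An object of the pre-triangulated hull of `B`: a one-sided twisted complex, that is, a formal
expression `(⨁ obj i [shift i], q)` with `q i j : obj i [shift i] ⟶ obj j [shift j]` of degree `1`,
strictly triangular, and such that `D q + q² = 0`. A morphism `X[r] ⟶ Y[s]` of degree `p` between
formal shifts is a morphism `X ⟶ Y` of degree `p + s - r`, and its differential is `(-1)ʳ` times
its differential in `B`. -/
structure TwistedComplex {k : Type w} [Field k] (B : DGCategory.{w, u} k) where
  len : ℕ
  obj : Fin len → B.Obj
  shift : Fin len → ℤ
  q : ∀ i j : Fin len, (B.Hom (obj i) (obj j)).X (1 + shift j - shift i)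
  one_sided : ∀ i j : Fin len, j ≤ i → q i j = 0
  maurer_cartan : ∀ i j : Fin len,
    ((shift i).negOnePow : ℤ) •
        (B.Hom (obj i) (obj j)).d _ (2 + shift j - shift i) (by omega) (q i j) +
      ∑ l, B.comp _ _ (2 + shift j - shift i) (by omega) (q i l) (q l j) = 0

lemma negOnePow_mul_self (a : ℤ) : (a.negOnePow : ℤ) * (a.negOnePow : ℤ) = 1 :=
  Int.units_coe_mul_self _

lemma negOnePow_mul_shift (a b p : ℤ) :
    (a.negOnePow : ℤ) * ((p + b - a).negOnePow : ℤ) = (p.negOnePow : ℤ) * (b.negOnePow : ℤ) := by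
  rw [Int.negOnePow_sub, Int.negOnePow_add]
  push_cast
  linear_combination ((p.negOnePow : ℤ) * (b.negOnePow : ℤ)) * negOnePow_mul_self a

namespace TwistedComplex

variable {k : Type w} [Field k] {B : DGCategory.{w, u} k}

/-- The product of matrices of morphisms between twisted complexes, of degrees `p` and `p'`. -/
def matMul (E E' E'' : TwistedComplex B) (p p' n : ℤ) (h : p + p' = n)
    (f : ∀ (i : Fin E.len) (j : Fin E'.len),
      (B.Hom (E.obj i) (E'.obj j)).X (p + E'.shift j - E.shift i))
    (g : ∀ (i : Fin E'.len) (j : Fin E''.len),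
      (B.Hom (E'.obj i) (E''.obj j)).X (p' + E''.shift j - E'.shift i))
    (i : Fin E.len) (j : Fin E''.len) :
    (B.Hom (E.obj i) (E''.obj j)).X (n + E''.shift j - E.shift i) :=
  ∑ l, B.comp _ _ _ (by omega) (f i l) (g l j)

/-- The differential of a matrix of morphisms between formal shifts, ignoring the twist `q`. -/
def matD (E E' : TwistedComplex B) (p p' : ℤ) (h : p + 1 = p')
    (f : ∀ (i : Fin E.len) (j : Fin E'.len),
      (B.Hom (E.obj i) (E'.obj j)).X (p + E'.shift j - E.shift i))
    (i : Fin E.len) (j : Fin E'.len) :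
    (B.Hom (E.obj i) (E'.obj j)).X (p' + E'.shift j - E.shift i) :=
  ((E.shift i).negOnePow : ℤ) • (B.Hom (E.obj i) (E'.obj j)).d _ _ (by omega) (f i j)

section

variable (E E' E'' E''' : TwistedComplex B)

/-- Matrices of morphisms of degree `p`. -/
abbrev Mat (E E' : TwistedComplex B) (p : ℤ) : Type u :=
  ∀ (i : Fin E.len) (j : Fin E'.len),
    (B.Hom (E.obj i) (E'.obj j)).X (p + E'.shift j - E.shift i)

lemma matMul_add (p p' n : ℤ) (h : p + p' = n) (f : Mat E E' p) (g g' : Mat E' E'' p') :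
    matMul E E' E'' p p' n h f (g + g') =
      matMul E E' E'' p p' n h f g + matMul E E' E'' p p' n h f g' := by
  funext i j
  simp [matMul, Finset.sum_add_distrib]

lemma add_matMul (p p' n : ℤ) (h : p + p' = n) (f f' : Mat E E' p) (g : Mat E' E'' p') :
    matMul E E' E'' p p' n h (f + f') g =
      matMul E E' E'' p p' n h f g + matMul E E' E'' p p' n h f' g := by
  funext i j
  simp [matMul, Finset.sum_add_distrib]

lemma matMul_smul (p p' n : ℤ) (h : p + p' = n) (c : k) (f : Mat E E' p) (g : Mat E' E'' p') :
    matMul E E' E'' p p' n h f (c • g) = c • matMul E E' E'' p p' n h f g := by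
  funext i j
  simp [matMul, Finset.smul_sum]

lemma smul_matMul (p p' n : ℤ) (h : p + p' = n) (c : k) (f : Mat E E' p) (g : Mat E' E'' p') :
    matMul E E' E'' p p' n h (c • f) g = c • matMul E E' E'' p p' n h f g := by
  funext i j
  simp [matMul, Finset.smul_sum]

/-- Matrix multiplication as a bilinear map. -/
def matMulₗ (p p' n : ℤ) (h : p + p' = n) : Mat E E' p →ₗ[k] Mat E' E'' p' →ₗ[k] Mat E E'' n :=
  LinearMap.mk₂ k (matMul E E' E'' p p' n h)
    (fun f f' g => add_matMul E E' E'' p p' n h f f' g)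
    (fun c f g => smul_matMul E E' E'' p p' n h c f g)
    (fun f g g' => matMul_add E E' E'' p p' n h f g g')
    (fun c f g => matMul_smul E E' E'' p p' n h c f g)

/-- `matD` as a linear map. -/
def matDₗ (p p' : ℤ) (h : p + 1 = p') : Mat E E' p →ₗ[k] Mat E E' p' where
  toFun := matD E E' p p' h
  map_add' f g := by funext i j; simp [matD]
  map_smul' c f := by
    funext i j
    simp only [matD, Pi.smul_apply, map_smul, RingHom.id_apply]
    rw [smul_comm]

lemma matMulₗ_assoc (a b c ab bc n : ℤ) (hab : a + b = ab) (hbc : b + c = bc) (h : ab + c = n)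
    (h' : a + bc = n) (x : Mat E E' a) (y : Mat E' E'' b) (z : Mat E'' E''' c) :
    matMulₗ E E'' E''' ab c n h (matMulₗ E E' E'' a b ab hab x y) z =
      matMulₗ E E' E''' a bc n h' x (matMulₗ E' E'' E''' b c bc hbc y z) := by
  funext i j
  simp only [matMulₗ, LinearMap.mk₂_apply, matMul, map_sum, LinearMap.sum_apply]
  rw [Finset.sum_comm]
  refine Finset.sum_congr rfl fun l _ => Finset.sum_congr rfl fun m _ => ?_
  exact B.assoc _ _ _ _ _ _ _ _ _ _ _ _

lemma matDₗ_matDₗ (p p' p'' : ℤ) (h : p + 1 = p') (h' : p' + 1 = p'') (x : Mat E E' p) :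
    matDₗ E E' p' p'' h' (matDₗ E E' p p' h x) = 0 := by
  funext i j
  simp [matDₗ, matD, DGModule.d_d]

lemma matDₗ_matMulₗ (p s n p' s' n' : ℤ) (h : p + s = n) (hp : p + 1 = p') (hs : s + 1 = s')
    (hn : n + 1 = n') (h₁ : p' + s = n') (h₂ : p + s' = n')
    (x : Mat E E' p) (y : Mat E' E'' s) :
    matDₗ E E'' n n' hn (matMulₗ E E' E'' p s n h x y) =
      matMulₗ E E' E'' p' s n' h₁ (matDₗ E E' p p' hp x) y +
        (p.negOnePow : ℤ) • matMulₗ E E' E'' p s' n' h₂ x (matDₗ E' E'' s s' hs y) := by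
  funext i j
  simp only [matDₗ, matMulₗ, LinearMap.mk₂_apply, matMul, matD, map_sum, LinearMap.coe_mk,
    AddHom.coe_mk, Pi.add_apply, Pi.smul_apply, map_zsmul, LinearMap.smul_apply, Finset.smul_sum,
    ← Finset.sum_add_distrib]
  refine Finset.sum_congr rfl fun l _ => ?_
  rw [B.leibniz _ _ _ (p' + E'.shift l - E.shift i) (s' + E''.shift j - E'.shift l) _ _
    (by omega) (by omega) (by omega), smul_add, smul_smul, smul_smul, negOnePow_mul_shift]

lemma maurer_cartanₗ : matDₗ E E 1 2 (by norm_num) E.q +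
    matMulₗ E E E 1 1 2 (by norm_num) E.q E.q = 0 := by
  funext i j
  exact E.maurer_cartan i j

end

/-- The differential of the complex of morphisms of twisted complexes:
`d f = D f + q f - (-1)ᵖ f q'` for `f` of degree `p`. -/
def dHom (E E' : TwistedComplex B) (p p' : ℤ) (h : p + 1 = p') : Mat E E' p →ₗ[k] Mat E E' p' :=
  matDₗ E E' p p' h + matMulₗ E E E' 1 p p' (by omega) E.q -
    (p.negOnePow : ℤ) • (matMulₗ E E' E' p 1 p' h).flip E'.q

lemma dHom_apply (E E' : TwistedComplex B) (p p' : ℤ) (h : p + 1 = p') (f : Mat E E' p) :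
    dHom E E' p p' h f = matDₗ E E' p p' h f + matMulₗ E E E' 1 p p' (by omega) E.q f -
      (p.negOnePow : ℤ) • matMulₗ E E' E' p 1 p' h f E'.q := rfl

lemma dHom_dHom (E E' : TwistedComplex B) (p p' p'' : ℤ) (h : p + 1 = p') (h' : p' + 1 = p'')
    (f : Mat E E' p) : dHom E E' p' p'' h' (dHom E E' p p' h f) = 0 := by
  have hε : (p'.negOnePow : ℤ) = -(p.negOnePow : ℤ) := by
    rw [← h, Int.negOnePow_succ]; simp
  have e1 := matDₗ_matMulₗ E E E' 1 p p' 2 p' p'' (by omega) (by norm_num) h h' (by omega)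
    (by omega) E.q f
  have e2 := matDₗ_matMulₗ E E' E' p 1 p' p' 2 p'' h h (by norm_num) h' (by omega)
    (by omega) f E'.q
  have m1 := congrArg (fun x => matMulₗ E E E' 2 p p'' (by omega) x f) (maurer_cartanₗ E)
  have m2 := congrArg (fun x => matMulₗ E E' E' p 2 p'' (by omega) f x) (maurer_cartanₗ E')
  simp only [map_add, LinearMap.add_apply, map_zero, LinearMap.zero_apply] at m1 m2
  rw [matMulₗ_assoc E E E E' 1 1 p 2 p' p'' _ (by omega) _ (by omega)] at m1
  rw [← matMulₗ_assoc E E' E' E' p 1 1 p' 2 p'' h _ (by omega)] at m2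
  have a1 := matMulₗ_assoc E E E' E' 1 p 1 p' p' p'' (by omega) h h' (by omega) E.q f E'.q
  rw [eq_neg_of_add_eq_zero_left m1] at e1
  rw [eq_neg_of_add_eq_zero_left m2] at e2
  simp only [dHom_apply, map_add, map_sub, map_zsmul, matDₗ_matDₗ, e1, e2, hε, a1]
  simp only [Int.negOnePow_one, Units.val_neg, Units.val_one, smul_add, smul_sub, smul_smul,
    neg_smul, smul_neg, negOnePow_mul_self, one_smul]
  abel

lemma dHom_matMulₗ (E E' E'' : TwistedComplex B) (p s n p' s' n' : ℤ) (h : p + s = n)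
    (hp : p + 1 = p') (hs : s + 1 = s') (hn : n + 1 = n') (h₁ : p' + s = n') (h₂ : p + s' = n')
    (f : Mat E E' p) (g : Mat E' E'' s) :
    dHom E E'' n n' hn (matMulₗ E E' E'' p s n h f g) =
      matMulₗ E E' E'' p' s n' h₁ (dHom E E' p p' hp f) g +
        (p.negOnePow : ℤ) • matMulₗ E E' E'' p s' n' h₂ f (dHom E' E'' s s' hs g) := by
  have a1 := matMulₗ_assoc E E E' E'' 1 p s p' n n' (by omega) h (by omega) (by omega) E.q f g
  have a2 := matMulₗ_assoc E E' E' E'' p 1 s p' s' n' hp (by omega) (by omega) (by omega) f E'.q g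
  have a3 := matMulₗ_assoc E E' E'' E'' p s 1 n s' n' h hs (by omega) (by omega) f g E''.q
  have hε : (n.negOnePow : ℤ) = (p.negOnePow : ℤ) * (s.negOnePow : ℤ) := by
    rw [← h, Int.negOnePow_add]; simp
  simp only [dHom_apply, LinearMap.add_apply, LinearMap.sub_apply, LinearMap.smul_apply,
    map_add, map_sub, map_zsmul, a1, a2, a3, hε,
    matDₗ_matMulₗ E E' E'' p s n p' s' n' h hp hs hn h₁ h₂]
  simp only [smul_add, smul_sub, smul_smul]
  abel

/-- The complex of morphisms of twisted complexes. -/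
def homComplex (E E' : TwistedComplex B) : DGModule.{w, u} k where
  X p := Mat E E' p
  d p p' h := dHom E E' p p' h
  d_d p p' p'' h h' f := dHom_dHom E E' p p' p'' h h' f

end TwistedComplex

/-- The identity of `X = Y`, seen in the degree `n = 0`. -/
def DGCategory.idOf {k : Type w} [Field k] (B : DGCategory.{w, u} k) (X Y : B.Obj) (n : ℤ)
    (hXY : X = Y) (hn : n = 0) : (B.Hom X Y).X n := by
  subst hXY hn
  exact B.id X

lemma DGCategory.idOf_comp {k : Type w} [Field k] (B : DGCategory.{w, u} k) {X Y : B.Obj}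
    (n i : ℤ) (hn : n = 0) (h : n + i = i) (f : (B.Hom X Y).X i) :
    B.comp n i i h (B.idOf X X n rfl hn) f = f := by
  subst hn
  exact B.id_comp i f

lemma DGCategory.comp_idOf {k : Type w} [Field k] (B : DGCategory.{w, u} k) {X Y : B.Obj}
    (n i : ℤ) (hn : n = 0) (h : i + n = i) (f : (B.Hom X Y).X i) :
    B.comp i n i h f (B.idOf Y Y n rfl hn) = f := by
  subst hn
  exact B.comp_id i f

lemma DGCategory.d_idOf {k : Type w} [Field k] (B : DGCategory.{w, u} k) {X : B.Obj}
    (n m : ℤ) (hn : n = 0) (h : n + 1 = m) :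
    (B.Hom X X).d n m h (B.idOf X X n rfl hn) = 0 := by
  subst hn h
  exact B.d_id X

namespace TwistedComplex

variable {k : Type w} [Field k] {B : DGCategory.{w, u} k}

/-- The identity matrix. -/
def idMat (E : TwistedComplex B) : Mat E E 0 := fun i j =>
  if h : i = j then B.idOf _ _ _ (congrArg E.obj h) (by rw [h]; omega) else 0

lemma idMat_mul (E E' : TwistedComplex B) (p : ℤ) (h : 0 + p = p) (f : Mat E E' p) :
    matMulₗ E E E' 0 p p h E.idMat f = f := by
  funext i j
  simp only [matMulₗ, LinearMap.mk₂_apply, matMul]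
  rw [Finset.sum_eq_single i]
  · simp [idMat, B.idOf_comp]
  · intro l _ hl
    simp [idMat, hl.symm]
  · simp

lemma mul_idMat (E E' : TwistedComplex B) (p : ℤ) (h : p + 0 = p) (f : Mat E E' p) :
    matMulₗ E E' E' p 0 p h f E'.idMat = f := by
  funext i j
  simp only [matMulₗ, LinearMap.mk₂_apply, matMul]
  rw [Finset.sum_eq_single j]
  · simp [idMat, B.comp_idOf]
  · intro l _ hl
    simp [idMat, hl]
  · simp

lemma matD_idMat (E : TwistedComplex B) : matDₗ E E 0 1 (by norm_num) E.idMat = 0 := by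
  funext i j
  by_cases h : i = j
  · subst h
    simp [matDₗ, matD, idMat, B.d_idOf]
  · simp [matDₗ, matD, idMat, h]

lemma dHom_idMat (E : TwistedComplex B) : dHom E E 0 1 (by norm_num) E.idMat = 0 := by
  rw [dHom_apply, matD_idMat, idMat_mul, mul_idMat]
  simp

end TwistedComplex

/-- The pre-triangulated hull of a DG category: the DG category of one-sided twisted complexes,
with composition given by matrix multiplication. -/
def preTr {k : Type w} [Field k] (B : DGCategory.{w, u} k) : DGCategory.{w, u} k where
  Obj := TwistedComplex B
  Hom := TwistedComplex.homComplex
  id := TwistedComplex.idMat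
  comp {E E' E''} p p' n h := TwistedComplex.matMulₗ E E' E'' p p' n h
  d_id E := TwistedComplex.dHom_idMat E
  leibniz {E E' E''} p s n p' s' n' h hp hs hn f g :=
    TwistedComplex.dHom_matMulₗ E E' E'' p s n p' s' n' h hp hs hn (by omega) (by omega) f g
  id_comp {E E'} p f := TwistedComplex.idMat_mul E E' p _ f
  comp_id {E E'} p f := TwistedComplex.mul_idMat E E' p _ f
  assoc {E E' E'' E'''} i j l ij jl n hij hjl h f g e :=
    TwistedComplex.matMulₗ_assoc E E' E'' E''' i j l ij jl n hij hjl h (by omega) f g e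

/-- Transport of homogeneous elements along an equality of degrees. -/
def DGModule.castX {k : Type w} [Field k] (M : DGModule.{w, u} k) (i j : ℤ) (h : i = j) :
    M.X i →ₗ[k] M.X j := by
  subst h
  exact LinearMap.id

lemma DGModule.d_castX {k : Type w} [Field k] (M : DGModule.{w, u} k) (i j l m : ℤ) (h : i = j)
    (hj : j + 1 = l) (hi : i + 1 = m) (hm : m = l) (x : M.X i) :
    M.d j l hj (M.castX i j h x) = M.castX m l hm (M.d i m hi x) := by
  subst h hm
  rfl

lemma DGCategory.comp_castX {k : Type w} [Field k] (B : DGCategory.{w, u} k) {X Y Z : B.Obj}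
    (i j n i' j' n' : ℤ) (h : i + j = n) (hi : i = i') (hj : j = j') (h' : i' + j' = n')
    (hn : n = n') (f : (B.Hom X Y).X i) (g : (B.Hom Y Z).X j) :
    B.comp i' j' n' h' ((B.Hom X Y).castX i i' hi f) ((B.Hom Y Z).castX j j' hj g) =
      (B.Hom X Z).castX n n' hn (B.comp i j n h f g) := by
  subst hi hj hn
  rfl

lemma DGCategory.castX_id {k : Type w} [Field k] (B : DGCategory.{w, u} k) (X : B.Obj)
    (n : ℤ) (h : 0 = n) : (B.Hom X X).castX 0 n h (B.id X) = B.idOf X X n rfl h.symm := by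
  subst h
  rfl

namespace TwistedComplex

variable {k : Type w} [Field k] {B : DGCategory.{w, u} k}

/-- The one-term twisted complex `X[n]`. -/
def single (X : B.Obj) (n : ℤ) : TwistedComplex B where
  len := 1
  obj _ := X
  shift _ := n
  q _ _ := 0
  one_sided _ _ _ := rfl
  maurer_cartan _ _ := by simp

/-- The underlying objects `X`, `Y` of the cone of a morphism from `X` to `Y`. -/
def coneObj (X Y : B.Obj) (i : Fin 2) : B.Obj := match i with
  | 0 => X
  | 1 => Y

/-- The shifts in `X[1] ⊕ Y`. -/
def coneShift (i : Fin 2) : ℤ := match i with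
  | 0 => 1
  | 1 => 0

/-- The twist of the cone of `f`: its only nonzero component is `f`, seen as a morphism
`X[1] ⟶ Y` of degree `1`. -/
def coneTwist {X Y : B.Obj} (f : (B.Hom X Y).X 0) (i j : Fin 2) :
    (B.Hom (coneObj X Y i) (coneObj X Y j)).X (1 + coneShift j - coneShift i) := match i, j with
  | 0, 1 => (B.Hom X Y).castX 0 _ (by simp [coneShift]) f
  | 0, 0 => 0
  | 1, 0 => 0
  | 1, 1 => 0

lemma d_coneTwist {X Y : B.Obj} (f : (B.Hom X Y).X 0)
    (hf : (B.Hom X Y).d 0 1 (by norm_num) f = 0) (i j : Fin 2) (n : ℤ)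
    (h : 1 + coneShift j - coneShift i + 1 = n) :
    (B.Hom (coneObj X Y i) (coneObj X Y j)).d _ n h (coneTwist f i j) = 0 := by
  match i, j with
  | 0, 0 => exact map_zero _
  | 1, 0 => exact map_zero _
  | 1, 1 => exact map_zero _
  | 0, 1 =>
    refine (DGModule.d_castX (B.Hom X Y) 0 _ n 1 _ h (by norm_num) ?_ f).trans ?_
    · rw [← h]; simp [coneShift]
    · rw [hf, map_zero]
      rfl

lemma coneTwist_comp_coneTwist {X Y : B.Obj} (f : (B.Hom X Y).X 0) (i l j : Fin 2) (n : ℤ)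
    (h : 1 + coneShift l - coneShift i + (1 + coneShift j - coneShift l) = n) :
    B.comp _ _ n h (coneTwist f i l) (coneTwist f l j) = 0 := by
  match i, l with
  | 0, 0 => exact LinearMap.map_zero₂ _ _
  | 1, 0 => exact LinearMap.map_zero₂ _ _
  | 1, 1 => exact LinearMap.map_zero₂ _ _
  | 0, 1 =>
    match j with
    | 0 => exact map_zero _
    | 1 => exact map_zero _

/-- The cone `(X[1] ⊕ Y, f)` of a closed morphism `f` of degree `0`. -/
def cone {X Y : B.Obj} (f : (B.Hom X Y).X 0) (hf : (B.Hom X Y).d 0 1 (by norm_num) f = 0) :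
    TwistedComplex B where
  len := 2
  obj := coneObj X Y
  shift := coneShift
  q := coneTwist f
  one_sided i j h := by
    fin_cases i <;> fin_cases j <;> first | rfl | simp at h
  maurer_cartan i j := by
    rw [d_coneTwist f hf, smul_zero, zero_add]
    exact Finset.sum_eq_zero fun l _ => coneTwist_comp_coneTwist f i l j _ _

lemma d_castX_id (X : B.Obj) (n m : ℤ) (hn : 0 = n) (h : n + 1 = m) :
    (B.Hom X X).d n m h ((B.Hom X X).castX 0 n hn (B.id X)) = 0 := by
  subst hn h
  exact B.d_id X

/-- The components of the inclusion `Y ⟶ X[1] ⊕ Y`. -/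
def coneInEntry (X Y : B.Obj) (j : Fin 2) :
    (B.Hom Y (coneObj X Y j)).X (0 + coneShift j - 0) := match j with
  | 0 => 0
  | 1 => (B.Hom Y Y).castX 0 _ (by simp [coneShift]) (B.id Y)

/-- The matrix of the inclusion `Y ⟶ cone f`. -/
def coneInMat {X Y : B.Obj} (f : (B.Hom X Y).X 0)
    (hf : (B.Hom X Y).d 0 1 (by norm_num) f = 0) : Mat (single Y 0) (cone f hf) 0 :=
  fun _ j => coneInEntry X Y j

/-- The components of the projection `X[1] ⊕ Y ⟶ X[1]`. -/
def coneOutEntry (X Y : B.Obj) (i : Fin 2) :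
    (B.Hom (coneObj X Y i) X).X (0 + 1 - coneShift i) := match i with
  | 0 => (B.Hom X X).castX 0 _ (by simp [coneShift]) (B.id X)
  | 1 => 0

/-- The matrix of the projection `cone f ⟶ X[1]`. -/
def coneOutMat {X Y : B.Obj} (f : (B.Hom X Y).X 0)
    (hf : (B.Hom X Y).d 0 1 (by norm_num) f = 0) : Mat (cone f hf) (single X 1) 0 :=
  fun i _ => coneOutEntry X Y i

lemma d_coneInEntry (X Y : B.Obj) (j : Fin 2) (n : ℤ) (h : 0 + coneShift j - 0 + 1 = n) :
    (B.Hom Y (coneObj X Y j)).d _ n h (coneInEntry X Y j) = 0 := by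
  match j with
  | 0 => exact map_zero _
  | 1 => exact d_castX_id Y _ _ _ _

lemma d_coneOutEntry (X Y : B.Obj) (i : Fin 2) (n : ℤ) (h : 0 + 1 - coneShift i + 1 = n) :
    (B.Hom (coneObj X Y i) X).d _ n h (coneOutEntry X Y i) = 0 := by
  match i with
  | 0 => exact d_castX_id X _ _ _ _
  | 1 => exact map_zero _

lemma coneInEntry_comp {X Y : B.Obj} (f : (B.Hom X Y).X 0) (l j : Fin 2) (n : ℤ)
    (h : 0 + coneShift l - 0 + (1 + coneShift j - coneShift l) = n) :
    B.comp _ _ n h (coneInEntry X Y l) (coneTwist f l j) = 0 := by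
  match l, j with
  | 0, _ => exact LinearMap.map_zero₂ _ _
  | 1, 0 => exact map_zero _
  | 1, 1 => exact map_zero _

lemma comp_coneOutEntry {X Y : B.Obj} (f : (B.Hom X Y).X 0) (i l : Fin 2) (n : ℤ)
    (h : 1 + coneShift l - coneShift i + (0 + 1 - coneShift l) = n) :
    B.comp _ _ n h (coneTwist f i l) (coneOutEntry X Y l) = 0 := by
  match i, l with
  | _, 1 => exact map_zero _
  | 0, 0 => exact LinearMap.map_zero₂ _ _
  | 1, 0 => exact LinearMap.map_zero₂ _ _

lemma matMulₗ_eq_zero (E E' E'' : TwistedComplex B) (p p' n : ℤ) (h : p + p' = n)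
    (f : Mat E E' p) (g : Mat E' E'' p')
    (H : ∀ i l j m hm, B.comp _ _ m hm (f i l) (g l j) = 0) :
    matMulₗ E E' E'' p p' n h f g = 0 := by
  funext i j
  simp only [matMulₗ, LinearMap.mk₂_apply, matMul]
  exact Finset.sum_eq_zero fun l _ => H i l j _ _

lemma matDₗ_eq_zero (E E' : TwistedComplex B) (p p' : ℤ) (h : p + 1 = p') (f : Mat E E' p)
    (H : ∀ i j m hm, (B.Hom (E.obj i) (E'.obj j)).d _ m hm (f i j) = 0) :
    matDₗ E E' p p' h f = 0 := by
  funext i j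
  simp [matDₗ, matD, H]

lemma matMulₗ_single (E E'' : TwistedComplex B) (Y : B.Obj) (n p p' r : ℤ) (h : p + p' = r)
    (f : Mat E (single Y n) p) (g : Mat (single Y n) E'' p') (i : Fin E.len) (j : Fin E''.len) :
    matMulₗ E (single Y n) E'' p p' r h f g i j =
      B.comp (X := E.obj i) (Y := Y) (Z := E''.obj j) (p + n - E.shift i)
        (p' + E''.shift j - n) (r + E''.shift j - E.shift i) (by omega)
        (f i (0 : Fin 1)) (g (0 : Fin 1) j) := by
  simp only [matMulₗ, LinearMap.mk₂_apply, matMul]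
  exact Fin.sum_univ_one _

lemma single_q_mul (X : B.Obj) (n : ℤ) (E : TwistedComplex B) (p p' : ℤ) (h : 1 + p = p')
    (f : Mat (single X n) E p) :
    matMulₗ (single X n) (single X n) E 1 p p' h (single X n).q f = 0 := by
  exact matMulₗ_eq_zero _ _ _ _ _ _ _ _ _ fun i l j m hm => LinearMap.map_zero₂ _ _

lemma mul_single_q (X : B.Obj) (n : ℤ) (E : TwistedComplex B) (p p' : ℤ) (h : p + 1 = p')
    (f : Mat E (single X n) p) :
    matMulₗ E (single X n) (single X n) p 1 p' h f (single X n).q = 0 := by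
  exact matMulₗ_eq_zero _ _ _ _ _ _ _ _ _ fun i l j m hm => map_zero _

lemma d_coneInMat {X Y : B.Obj} (f : (B.Hom X Y).X 0)
    (hf : (B.Hom X Y).d 0 1 (by norm_num) f = 0) :
    dHom (single Y 0) (cone f hf) 0 1 (by norm_num) (coneInMat f hf) = 0 := by
  have e1 : matDₗ (single Y 0) (cone f hf) 0 1 (by norm_num) (coneInMat f hf) = 0 :=
    matDₗ_eq_zero _ _ _ _ _ _ fun _ j m hm => d_coneInEntry X Y j m hm
  have e2 : matMulₗ (single Y 0) (cone f hf) (cone f hf) 0 1 1 (by norm_num) (coneInMat f hf)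
      (cone f hf).q = 0 :=
    matMulₗ_eq_zero _ _ _ _ _ _ _ _ _ fun _ l j m hm => coneInEntry_comp f l j m hm
  rw [dHom_apply, e1, e2, single_q_mul]
  simp

lemma d_coneOutMat {X Y : B.Obj} (f : (B.Hom X Y).X 0)
    (hf : (B.Hom X Y).d 0 1 (by norm_num) f = 0) :
    dHom (cone f hf) (single X 1) 0 1 (by norm_num) (coneOutMat f hf) = 0 := by
  have e1 : matDₗ (cone f hf) (single X 1) 0 1 (by norm_num) (coneOutMat f hf) = 0 :=
    matDₗ_eq_zero _ _ _ _ _ _ fun i _ m hm => d_coneOutEntry X Y i m hm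
  have e2 : matMulₗ (cone f hf) (cone f hf) (single X 1) 1 0 1 (by norm_num) (cone f hf).q
      (coneOutMat f hf) = 0 :=
    matMulₗ_eq_zero _ _ _ _ _ _ _ _ _ fun i l _ m hm => comp_coneOutEntry f i l m hm
  rw [dHom_apply, e1, e2, mul_single_q]
  simp

lemma dHom_single (X Y : B.Obj) (m n p p' : ℤ) (h : p + 1 = p')
    (f : Mat (single X m) (single Y n) p) :
    dHom (single X m) (single Y n) p p' h f =
      fun i j => (m.negOnePow : ℤ) •
        (B.Hom X Y).d (p + n - m) (p' + n - m) (by omega) (f i j) := by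
  rw [dHom_apply, single_q_mul, mul_single_q, smul_zero, add_zero, sub_zero]
  rfl

/-- The `1 × 1` matrices with entry in `Hom X Y`. -/
def embMat (X Y : B.Obj) (p : ℤ) :
    (B.Hom X Y).X p →ₗ[k] Mat (single X 0) (single Y 0) p :=
  LinearMap.pi fun _ => LinearMap.pi fun _ => (B.Hom X Y).castX p (p + 0 - 0) (by omega)

end TwistedComplex

/-- The canonical embedding of a DG category into its pre-triangulated hull. -/
def preTrEmbedding {k : Type w} [Field k] (B : DGCategory.{w, u} k) : DGFunctor B (preTr B) where
  obj X := TwistedComplex.single X 0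
  map X Y :=
    { f := fun p => TwistedComplex.embMat X Y p
      comm := fun p p' h x => by
        refine Eq.trans ?_ (TwistedComplex.dHom_single X Y 0 0 p p' h _).symm
        funext i j
        simp only [Int.negOnePow_zero, Units.val_one, one_smul]
        exact (DGModule.d_castX (B.Hom X Y) p _ _ p' _ _ h (by omega) x).symm }
  map_id X := by
    funext i j
    obtain rfl : i = j := Subsingleton.elim (α := Fin 1) i j
    refine (B.castX_id X (0 + 0 - 0) (by norm_num)).trans ?_
    change _ = TwistedComplex.idMat (TwistedComplex.single X 0) i i
    rw [TwistedComplex.idMat, dif_pos rfl]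
    rfl
  map_comp {X Y Z} p s n h f g := by
    funext i j
    refine Eq.trans ?_ (TwistedComplex.matMulₗ_single (TwistedComplex.single X 0)
      (TwistedComplex.single Z 0) Y 0 p s n h (TwistedComplex.embMat X Y p f)
      (TwistedComplex.embMat Y Z s g) i j).symm
    exact (B.comp_castX p s n _ _ _ h _ _ _ (by omega) f g).symm

namespace DGCategory

variable {k : Type w} [Field k]

/-- `X[n]` as an object of the homotopy category of the pre-triangulated hull. -/
def formalShift (B : DGCategory.{w, u} k) (X : B.Obj) (n : ℤ) : H0 (preTr B) :=
  TwistedComplex.single X n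

/-- `cone f` as an object of the homotopy category of the pre-triangulated hull. -/
def formalCone (B : DGCategory.{w, u} k) {X Y : B.Obj} (f : (B.Hom X Y).X 0)
    (hf : (B.Hom X Y).d 0 1 (by norm_num) f = 0) : H0 (preTr B) :=
  TwistedComplex.cone f hf

/-- The canonical morphism `Y ⟶ cone f`. -/
def coneIn (B : DGCategory.{w, u} k) {X Y : B.Obj} (f : (B.Hom X Y).X 0)
    (hf : (B.Hom X Y).d 0 1 (by norm_num) f = 0) :
    (preTrEmbedding B).mapH0.obj Y ⟶ B.formalCone f hf :=
  H0.homMk (preTr B) (TwistedComplex.coneInMat f hf) (TwistedComplex.d_coneInMat f hf)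

/-- The canonical morphism `cone f ⟶ X[1]`. -/
def coneOut (B : DGCategory.{w, u} k) {X Y : B.Obj} (f : (B.Hom X Y).X 0)
    (hf : (B.Hom X Y).d 0 1 (by norm_num) f = 0) :
    B.formalCone f hf ⟶ B.formalShift X 1 :=
  H0.homMk (preTr B) (TwistedComplex.coneOutMat f hf) (TwistedComplex.d_coneOutMat f hf)

/-- `B` is pre-triangulated: in the pre-triangulated hull, all shifts `X[n]` of objects of `B` and
all cones of closed morphisms of degree `0` in `B` are homotopy equivalent to objects of `B`. -/
class IsPreTriangulated (B : DGCategory.{w, u} k) : Prop where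
  shift : ∀ (X : B.Obj) (n : ℤ), ∃ Y : B.Obj,
    Nonempty ((preTrEmbedding B).mapH0.obj Y ≅ B.formalShift X n)
  cone : ∀ {X Y : B.Obj} (f : (B.Hom X Y).X 0) (hf : (B.Hom X Y).d 0 1 (by norm_num) f = 0),
    ∃ Z : B.Obj, Nonempty ((preTrEmbedding B).mapH0.obj Z ≅ B.formalCone f hf)

/-- A chosen object `X⟦n⟧` of a pre-triangulated DG category `B`. -/
noncomputable def shiftObj (B : DGCategory.{w, u} k) [B.IsPreTriangulated] (n : ℤ) (X : B.Obj) :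
    B.Obj :=
  (IsPreTriangulated.shift X n).choose

/-- The chosen homotopy equivalence of `X⟦n⟧` with `X[n]` in the pre-triangulated hull. -/
noncomputable def shiftIso (B : DGCategory.{w, u} k) [B.IsPreTriangulated] (n : ℤ) (X : B.Obj) :
    (preTrEmbedding B).mapH0.obj (B.shiftObj n X) ≅ B.formalShift X n :=
  (IsPreTriangulated.shift X n).choose_spec.some

end DGCategory

/-- The graded homotopy category of `B`: same objects as `B`, morphisms the homogeneous elements
of the cohomology of the morphism complexes. -/
def GrH {k : Type w} [Field k] (B : DGCategory.{w, u} k) : Type u := B.Obj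

namespace GrH

variable {k : Type w} [Field k]

/-- Homogeneous elements of the cohomology of the morphism complexes. -/
abbrev Hom (B : DGCategory.{w, u} k) (X Y : B.Obj) : Type u := Σ n : ℤ, (B.Hom X Y).H n

/-- Composition of homogeneous elements. -/
def comp (B : DGCategory.{w, u} k) {X Y Z : B.Obj} (f : Hom B X Y) (g : Hom B Y Z) : Hom B X Z :=
  ⟨f.1 + g.1, B.compH _ _ _ rfl f.2 g.2⟩

lemma comp_mk (B : DGCategory.{w, u} k) {X Y Z : B.Obj} (i j n : ℤ) (h : i + j = n)
    (f : (B.Hom X Y).H i) (g : (B.Hom Y Z).H j) :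
    comp B (⟨i, f⟩ : Hom B X Y) (⟨j, g⟩ : Hom B Y Z) = ⟨n, B.compH i j n h f g⟩ := by
  subst h
  rfl

instance category (B : DGCategory.{w, u} k) : Category.{u} (GrH B) where
  Hom X Y := Hom B X Y
  id X := ⟨0, B.idH X⟩
  comp f g := comp B f g
  id_comp := by
    rintro X Y ⟨i, f⟩
    exact (comp_mk B 0 i i (zero_add i) (B.idH X) f).trans (congrArg (Sigma.mk i) (B.idH_comp i _ f))
  comp_id := by
    rintro X Y ⟨i, f⟩
    exact (comp_mk B i 0 i (add_zero i) f (B.idH Y)).trans (congrArg (Sigma.mk i) (B.comp_idH i _ f))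
  assoc := by
    rintro X Y Z W ⟨i, f⟩ ⟨j, g⟩ ⟨l, e⟩
    refine (comp_mk B (i + j) l (i + (j + l)) (by omega) (B.compH i j _ rfl f g) e).trans ?_
    exact congrArg (Sigma.mk (i + (j + l)))
      (B.assocH i j l (i + j) (j + l) (i + (j + l)) rfl rfl _ rfl f g e)

/-- The inclusion of `H⁰(B)` into the graded homotopy category. -/
def incl (B : DGCategory.{w, u} k) : H0 B ⥤ GrH B where
  obj X := X
  map {X Y} f := (⟨0, f⟩ : Hom B X Y)
  map_id _ := rfl
  map_comp f g := (comp_mk B 0 0 0 (by norm_num) f g).symm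

instance (B : DGCategory.{w, u} k) : (incl B).Faithful where
  map_injective h := eq_of_heq (Sigma.mk.inj h).2

/-- A homogeneous element of degree `0`, as a morphism of `H⁰(B)`. -/
def toH0 (B : DGCategory.{w, u} k) {X Y : H0 B} (f : (incl B).obj X ⟶ (incl B).obj Y)
    (hf : f.1 = 0) : X ⟶ Y :=
  (hf ▸ f.2 : (DGCategory.Hom B X Y).H 0)

@[simp]
lemma incl_toH0 (B : DGCategory.{w, u} k) {X Y : H0 B} (f : (incl B).obj X ⟶ (incl B).obj Y)
    (hf : f.1 = 0) : (incl B).map (toH0 B f hf) = f := by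
  obtain ⟨n, f⟩ := f
  dsimp at hf
  subst hf
  rfl

/-- The entry of a closed matrix of degree `0` between one-term twisted complexes. -/
def entryCocycles (B : DGCategory.{w, u} k) (X Y : B.Obj) (m n : ℤ) :
    ((preTr B).Hom (TwistedComplex.single X m) (TwistedComplex.single Y n)).cocycles 0 →ₗ[k]
      (B.Hom X Y).cocycles (0 + n - m) where
  toFun f := ⟨(f.1 : TwistedComplex.Mat _ _ _) (0 : Fin 1) (0 : Fin 1), by
    have hf : TwistedComplex.dHom (TwistedComplex.single X m) (TwistedComplex.single Y n) 0
      (0 + 1) rfl f.1 = 0 := f.2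
    have h := congrFun (congrFun ((TwistedComplex.dHom_single X Y m n 0 (0 + 1) rfl f.1).symm.trans
      hf) (0 : Fin 1)) (0 : Fin 1)
    have h' : (m.negOnePow : ℤ) • (B.Hom X Y).d (0 + n - m) (0 + 1 + n - m) (by omega)
      ((f.1 : TwistedComplex.Mat _ _ _) (0 : Fin 1) (0 : Fin 1)) = 0 := h
    have h'' := congrArg (fun x => (m.negOnePow : ℤ) • x) h'
    simp only [smul_smul, negOnePow_mul_self, one_smul, smul_zero] at h''
    have e := (B.Hom X Y).d_castX (0 + n - m) (0 + n - m) (0 + n - m + 1) (0 + 1 + n - m) rfl rfl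
      (by omega) (by omega) ((f.1 : TwistedComplex.Mat _ _ _) (0 : Fin 1) (0 : Fin 1))
    rw [h'', map_zero] at e
    exact e⟩
  map_add' _ _ := rfl
  map_smul' _ _ := rfl

/-- The map induced on cohomology by `entryCocycles`. -/
def entryH (B : DGCategory.{w, u} k) (X Y : B.Obj) (m n : ℤ) :
    ((preTr B).Hom (TwistedComplex.single X m) (TwistedComplex.single Y n)).H 0 →ₗ[k]
      (B.Hom X Y).H (0 + n - m) :=
  Submodule.mapQ _ _ (entryCocycles B X Y m n) (by
    rintro ⟨_, hx⟩ ⟨y, rfl⟩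
    have key : ∀ z : (B.Hom X Y).X (0 - 1 + n - m),
        (B.Hom X Y).d (0 + n - m - 1) (0 + n - m) (by omega)
          ((m.negOnePow : ℤ) • (B.Hom X Y).castX (0 - 1 + n - m) _ (by omega) z) =
        (m.negOnePow : ℤ) • (B.Hom X Y).d (0 - 1 + n - m) (0 + n - m) (by omega) z := by
      intro z
      rw [map_zsmul, DGModule.d_castX _ _ _ _ (0 + n - m) _ _ (by omega) rfl]
      rfl
    refine ⟨_, (key ((y : TwistedComplex.Mat _ _ _) (0 : Fin 1) (0 : Fin 1))).trans ?_⟩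
    exact (congrFun (congrFun (TwistedComplex.dHom_single X Y m n (0 - 1) 0 (by norm_num) y)
      (0 : Fin 1)) (0 : Fin 1)).symm)

/-- A morphism `X[m] ⟶ Y[n]` in the homotopy category of the pre-triangulated hull, as a
homogeneous element of degree `n - m` of the cohomology of `Hom X Y`. -/
def entry (B : DGCategory.{w, u} k) {X Y : B.Obj} {m n : ℤ}
    (f : B.formalShift X m ⟶ B.formalShift Y n) :
    (show GrH B from X) ⟶ (show GrH B from Y) :=
  (⟨0 + n - m, entryH B X Y m n f⟩ : Hom B X Y)

lemma entry_fst (B : DGCategory.{w, u} k) {X Y : B.Obj} {m n : ℤ}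
    (f : B.formalShift X m ⟶ B.formalShift Y n) : (entry B f).1 = n - m :=
  congrArg (· - m) (zero_add n)

lemma entry_id (B : DGCategory.{w, u} k) (X : B.Obj) (m : ℤ) :
    entry B (𝟙 (B.formalShift X m)) = 𝟙 _ := by
  have h : ∀ (n : ℤ) (hn : n = 0) (hc : B.idOf X X n rfl hn ∈ (B.Hom X X).cocycles n),
      (⟨n, Submodule.Quotient.mk ⟨B.idOf X X n rfl hn, hc⟩⟩ : Hom B X X) = ⟨0, B.idH X⟩ := by
    rintro n rfl hc
    rfl
  exact h (0 + m - m) (by omega) (B.d_idOf _ _ _ _)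

lemma entry_comp (B : DGCategory.{w, u} k) {X Y Z : B.Obj} {m n l : ℤ}
    (f : B.formalShift X m ⟶ B.formalShift Y n) (g : B.formalShift Y n ⟶ B.formalShift Z l) :
    entry B (f ≫ g) = entry B f ≫ entry B g := by
  refine Eq.trans ?_ (comp_mk B (0 + n - m) (0 + l - n) (0 + l - m) (by omega)
    (entryH B X Y m n f) (entryH B Y Z n l g)).symm
  refine congrArg (Sigma.mk (0 + l - m)) ?_
  obtain ⟨f, rfl⟩ := Submodule.Quotient.mk_surjective _ f
  obtain ⟨g, rfl⟩ := Submodule.Quotient.mk_surjective _ g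
  refine congrArg Submodule.Quotient.mk (Subtype.ext ?_)
  exact TwistedComplex.matMulₗ_single (TwistedComplex.single X m) (TwistedComplex.single Z l) Y n
    0 0 0 (by norm_num) f.1 g.1 (0 : Fin 1) (0 : Fin 1)

end GrH

namespace H0

open GrH

variable {k : Type w} [Field k] (B : DGCategory.{w, u} k)

lemma comp_fst {X Y Z : GrH B} (f : X ⟶ Y) (g : Y ⟶ Z) : (f ≫ g).1 = f.1 + g.1 := rfl

/-- A degree `0` isomorphism of the graded homotopy category, as an isomorphism of `H⁰(B)`. -/
def isoToH0 {X Y : H0 B} (φ : (incl B).obj X ≅ (incl B).obj Y) (h : φ.hom.1 = 0)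
    (h' : φ.inv.1 = 0) : X ≅ Y where
  hom := toH0 B φ.hom h
  inv := toH0 B φ.inv h'
  hom_inv_id := (incl B).map_injective (by simp)
  inv_hom_id := (incl B).map_injective (by simp)

lemma incl_isoToH0_hom {X Y : H0 B} (φ : (incl B).obj X ≅ (incl B).obj Y) (h : φ.hom.1 = 0)
    (h' : φ.inv.1 = 0) : (incl B).map (isoToH0 B φ h h').hom = φ.hom :=
  incl_toH0 B _ _

lemma incl_isoToH0_inv {X Y : H0 B} (φ : (incl B).obj X ≅ (incl B).obj Y) (h : φ.hom.1 = 0)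
    (h' : φ.inv.1 = 0) : (incl B).map (isoToH0 B φ h h').inv = φ.inv :=
  incl_toH0 B _ _

section

variable {G : Type u} [Category.{u} G]

lemma shift_aux₀ {x y x' y' : G} (s : x' ≅ x) (t : y' ≅ y) (f : x ⟶ y) :
    (s.hom ≫ f ≫ t.inv) ≫ t.hom = s.hom ≫ f := by
  simp

lemma shift_aux₁ {x y x' y' xa ya xb yb : G} (s : x' ≅ x) (t : y' ≅ y) (s' : xa ≅ x) (t' : ya ≅ y)
    (s'' : xb ≅ xa) (t'' : yb ≅ ya) (f : x ⟶ y) :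
    (s.hom ≫ f ≫ t.inv) ≫ t.hom ≫ t'.inv ≫ t''.inv =
      (s.hom ≫ s'.inv ≫ s''.inv) ≫ s''.hom ≫ (s'.hom ≫ f ≫ t'.inv) ≫ t''.inv := by
  simp

lemma shift_aux₂ {x x₁ x₂ x₃ x₄ x₅ x₆ x₇ x₈ : G} (e : x₁ ⟶ x₂) (u : x₁ ⟶ x) (v : x₂ ⟶ x)
    (h : e ≫ v = u) (s₁ : x₃ ≅ x) (s₂ : x₄ ≅ x) (s₃ : x₅ ≅ x₄) (s₄ : x₆ ≅ x₄) (s₅ : x₇ ≅ x₃)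
    (s₆ : x₈ ≅ x₅) :
    (u ≫ s₁.inv ≫ s₅.inv) ≫ s₅.hom ≫ (s₁.hom ≫ s₂.inv ≫ s₃.inv) ≫ s₆.inv =
      e ≫ (v ≫ s₂.inv ≫ s₄.inv) ≫ s₄.hom ≫ s₃.inv ≫ s₆.inv := by
  subst h
  simp

lemma shift_aux₃ {x x₁ x₂ y : G} (e : x₁ ⟶ x₂) (u : x₁ ⟶ x) (v : x₂ ⟶ x) (h : e ≫ v = u)
    (s : x ⟶ y) : u ≫ s = e ≫ v ≫ s := by
  subst h
  simp

lemma shift_aux₄ {x x₁ x₂ y : G} (e : x₁ ⟶ x₂) (u : x₁ ⟶ x) (v : x₂ ≅ x) (h : e ≫ v.hom = u)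
    (s : x₂ ⟶ y) : u ≫ v.inv ≫ s = e ≫ s := by
  subst h
  simp

end

variable [B.IsPreTriangulated]

/-- The object `X⟦n⟧` of `H⁰(B)`. -/
noncomputable def shiftOb (n : ℤ) (X : H0 B) : H0 B := B.shiftObj n X

/-- The chosen isomorphism of degree `n` from `X⟦n⟧` to `X` in the graded homotopy category. -/
noncomputable def shiftGr (n : ℤ) (X : H0 B) :
    (incl B).obj (shiftOb B n X) ≅ (incl B).obj X where
  hom := entry B (m := 0) (n := n) (B.shiftIso n X).hom
  inv := entry B (m := n) (n := 0) (B.shiftIso n X).inv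
  hom_inv_id := (entry_comp B (m := 0) (l := 0) (B.shiftIso n X).hom (B.shiftIso n X).inv).symm.trans
    ((congrArg (entry B (m := 0) (n := 0)) (B.shiftIso n X).hom_inv_id).trans (entry_id B _ 0))
  inv_hom_id := (entry_comp B (n := 0) (B.shiftIso n X).inv (B.shiftIso n X).hom).symm.trans
    ((congrArg (entry B) (B.shiftIso n X).inv_hom_id).trans (entry_id B _ n))

lemma shiftGr_hom_fst (n : ℤ) (X : H0 B) : (shiftGr B n X).hom.1 = n :=
  (entry_fst B (m := 0) (n := n) _).trans (sub_zero n)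

lemma shiftGr_inv_fst (n : ℤ) (X : H0 B) : (shiftGr B n X).inv.1 = -n :=
  (entry_fst B (m := n) (n := 0) _).trans (zero_sub n)

/-- The shift functor `X ↦ X⟦n⟧` of `H⁰(B)`: it sends `f` to the morphism corresponding to `f`
under the isomorphisms of degree `n` of `X⟦n⟧` with `X`. -/
noncomputable def shiftF (n : ℤ) : H0 B ⥤ H0 B where
  obj X := shiftOb B n X
  map {X Y} f := toH0 B ((shiftGr B n X).hom ≫ (incl B).map f ≫ (shiftGr B n Y).inv) (by
    rw [comp_fst, comp_fst, shiftGr_hom_fst, shiftGr_inv_fst]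
    change n + (0 + -n) = 0
    omega)
  map_id X := (incl B).map_injective (by
    rw [incl_toH0, CategoryTheory.Functor.map_id, CategoryTheory.Functor.map_id, Category.id_comp,
      Iso.hom_inv_id])
  map_comp {X Y Z} f g := (incl B).map_injective (by
    refine (incl_toH0 B _ _).trans (Eq.trans ?_ ((incl B).map_comp _ _).symm)
    rw [incl_toH0, incl_toH0, CategoryTheory.Functor.map_comp]
    simp only [Category.assoc, Iso.inv_hom_id_assoc])

lemma shiftF_obj (n : ℤ) (X : H0 B) : (shiftF B n).obj X = shiftOb B n X := rfl

lemma incl_shiftF_map (n : ℤ) {X Y : H0 B} (f : X ⟶ Y) :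
    (incl B).map ((shiftF B n).map f) =
      (shiftGr B n X).hom ≫ (incl B).map f ≫ (shiftGr B n Y).inv :=
  incl_toH0 B _ _

/-- The isomorphism `X⟦0⟧ ≅ X`. -/
noncomputable def shiftZeroIso : shiftF B 0 ≅ 𝟭 (H0 B) :=
  NatIso.ofComponents (fun X => isoToH0 B (shiftGr B 0 X) (shiftGr_hom_fst B 0 X)
      (shiftGr_inv_fst B 0 X)) (by
    intro X Y f
    apply (incl B).map_injective
    refine ((incl B).map_comp _ _).trans (Eq.trans ?_ ((incl B).map_comp _ _).symm)
    refine (congrArg₂ (fun u v => u ≫ v) (incl_shiftF_map B 0 f)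
      (incl_isoToH0_hom B (shiftGr B 0 Y) _ _)).trans ?_
    refine Eq.trans ?_ (congrArg (fun u => u ≫ (incl B).map f)
      (incl_isoToH0_hom B (shiftGr B 0 X) _ _)).symm
    exact shift_aux₀ (shiftGr B 0 X) (shiftGr B 0 Y) ((incl B).map f))

/-- The isomorphism `X⟦a + b⟧ ≅ X⟦a⟧⟦b⟧` in the graded homotopy category. -/
noncomputable def shiftAddGr (a b : ℤ) (X : H0 B) :
    (incl B).obj (shiftOb B (a + b) X) ≅ (incl B).obj (shiftOb B b (shiftOb B a X)) :=
  shiftGr B (a + b) X ≪≫ (shiftGr B a X).symm ≪≫ (shiftGr B b (shiftOb B a X)).symm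

lemma shiftAddGr_hom (a b : ℤ) (X : H0 B) : (shiftAddGr B a b X).hom =
    (shiftGr B (a + b) X).hom ≫ (shiftGr B a X).inv ≫ (shiftGr B b (shiftOb B a X)).inv := rfl

lemma shiftAddGr_inv (a b : ℤ) (X : H0 B) : (shiftAddGr B a b X).inv =
    ((shiftGr B b (shiftOb B a X)).hom ≫ (shiftGr B a X).hom) ≫ (shiftGr B (a + b) X).inv := rfl

lemma shiftAddGr_hom_fst (a b : ℤ) (X : H0 B) : (shiftAddGr B a b X).hom.1 = 0 := by
  rw [shiftAddGr_hom, comp_fst, comp_fst, shiftGr_hom_fst, shiftGr_inv_fst, shiftGr_inv_fst]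
  omega

lemma shiftAddGr_inv_fst (a b : ℤ) (X : H0 B) : (shiftAddGr B a b X).inv.1 = 0 := by
  rw [shiftAddGr_inv, comp_fst, comp_fst, shiftGr_hom_fst, shiftGr_hom_fst, shiftGr_inv_fst]
  omega

/-- The isomorphism `X⟦a + b⟧ ≅ X⟦a⟧⟦b⟧`. -/
noncomputable def shiftAddIso (a b : ℤ) : shiftF B (a + b) ≅ shiftF B a ⋙ shiftF B b :=
  NatIso.ofComponents (fun X => isoToH0 B (shiftAddGr B a b X) (shiftAddGr_hom_fst B a b X)
    (shiftAddGr_inv_fst B a b X)) (by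
    intro X Y f
    apply (incl B).map_injective
    refine ((incl B).map_comp _ _).trans (Eq.trans ?_ ((incl B).map_comp _ _).symm)
    refine (congrArg₂ (fun u v => u ≫ v) (incl_shiftF_map B (a + b) f)
      (incl_isoToH0_hom B (shiftAddGr B a b Y) _ _)).trans ?_
    refine Eq.trans ?_ (congrArg₂ (fun u v => u ≫ v)
      (incl_isoToH0_hom B (shiftAddGr B a b X) _ _)
      ((incl_shiftF_map B b ((shiftF B a).map f)).trans
        (congrArg (fun u => (shiftGr B b _).hom ≫ u ≫ (shiftGr B b _).inv)
          (incl_shiftF_map B a f)))).symm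
    exact shift_aux₁ (shiftGr B (a + b) X) (shiftGr B (a + b) Y) (shiftGr B a X) (shiftGr B a Y)
      (shiftGr B b (shiftOb B a X)) (shiftGr B b (shiftOb B a Y)) ((incl B).map f))

lemma eqToHom_shiftGr {m n : ℤ} (h : m = n) (X : H0 B) (h' : shiftOb B m X = shiftOb B n X) :
    (incl B).map (eqToHom h') ≫ (shiftGr B n X).hom = (shiftGr B m X).hom := by
  subst h
  simp

lemma incl_shiftZeroIso_inv (X : H0 B) :
    (incl B).map ((shiftZeroIso B).inv.app X) = (shiftGr B 0 X).inv :=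
  incl_isoToH0_inv B (shiftGr B 0 X) (shiftGr_hom_fst B 0 X) (shiftGr_inv_fst B 0 X)

lemma incl_shiftAddIso_hom (a b : ℤ) (X : H0 B) :
    (incl B).map ((shiftAddIso B a b).hom.app X) =
      (shiftGr B (a + b) X).hom ≫ (shiftGr B a X).inv ≫ (shiftGr B b (shiftOb B a X)).inv :=
  incl_isoToH0_hom B (shiftAddGr B a b X) (shiftAddGr_hom_fst B a b X) (shiftAddGr_inv_fst B a b X)

/-- The shift functors on `H⁰(B)` and their coherence isomorphisms. -/
noncomputable def shiftCore : ShiftMkCore (H0 B) ℤ where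
  F := shiftF B
  zero := shiftZeroIso B
  add a b := shiftAddIso B a b
  assoc_hom_app a b c X := (incl B).map_injective (by
    refine ((incl B).map_comp _ _).trans (Eq.trans ?_ ((incl B).map_comp _ _).symm)
    refine (congrArg₂ (fun u v => u ≫ v) (incl_shiftAddIso_hom B (a + b) c X)
      ((incl_shiftF_map B c _).trans
        (congrArg (fun u => (shiftGr B c _).hom ≫ u ≫ (shiftGr B c _).inv)
          (incl_shiftAddIso_hom B a b X)))).trans ?_
    refine Eq.trans ?_ (congrArg (fun u => (incl B).map (eqToHom _) ≫ u)
      (((incl B).map_comp _ _).trans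
        (congrArg₂ (fun u v => u ≫ v) (incl_shiftAddIso_hom B a (b + c) X)
          (incl_shiftAddIso_hom B b c (shiftOb B a X))))).symm
    exact shift_aux₂ ((incl B).map (eqToHom _)) (shiftGr B (a + b + c) X).hom
      (shiftGr B (a + (b + c)) X).hom
      (eqToHom_shiftGr B (add_assoc a b c) X (congrArg (fun n => shiftOb B n X) (add_assoc a b c)))
      (shiftGr B (a + b) X) (shiftGr B a X) (shiftGr B b (shiftOb B a X))
      (shiftGr B (b + c) (shiftOb B a X)) (shiftGr B c (shiftOb B (a + b) X))
      (shiftGr B c (shiftOb B b (shiftOb B a X))))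
  zero_add_hom_app n X := (incl B).map_injective (by
    refine (incl_shiftAddIso_hom B 0 n X).trans (Eq.trans ?_ ((incl B).map_comp _ _).symm)
    refine Eq.trans ?_ (congrArg (fun u => (incl B).map (eqToHom _) ≫ u)
      ((incl_shiftF_map B n _).trans
        (congrArg (fun u => (shiftGr B n _).hom ≫ u ≫ (shiftGr B n _).inv)
          (incl_shiftZeroIso_inv B X)))).symm
    exact shift_aux₃ ((incl B).map (eqToHom _)) (shiftGr B (0 + n) X).hom (shiftGr B n X).hom
      (eqToHom_shiftGr B (zero_add n) X (congrArg (fun n => shiftOb B n X) (zero_add n))) _)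
  add_zero_hom_app n X := (incl B).map_injective (by
    refine (incl_shiftAddIso_hom B n 0 X).trans (Eq.trans ?_ ((incl B).map_comp _ _).symm)
    refine Eq.trans ?_ (congrArg (fun u => (incl B).map (eqToHom _) ≫ u)
      (incl_shiftZeroIso_inv B (shiftOb B n X))).symm
    exact shift_aux₄ ((incl B).map (eqToHom _)) (shiftGr B (n + 0) X).hom (shiftGr B n X)
      (eqToHom_shiftGr B (add_zero n) X (congrArg (fun n => shiftOb B n X) (add_zero n))) _)

noncomputable instance hasShift : HasShift (H0 B) ℤ := hasShiftMk (H0 B) ℤ (shiftCore B)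

/-- The distinguished triangles of `H⁰(B)`, for `B` pre-triangulated: the triangles isomorphic to
`X ⟶ Y ⟶ Z ⟶ X⟦1⟧`, where `f : X ⟶ Y` is a closed morphism of degree `0` of `B`, the object `Z`
is homotopy equivalent to `cone f` in the pre-triangulated hull, and the last two morphisms
correspond to the canonical morphisms `Y ⟶ cone f ⟶ X[1]`. -/
def distTriangles : Set (Pretriangulated.Triangle (H0 B)) :=
  fun T => ∃ (X Y Z : H0 B) (f : (DGCategory.Hom B X Y).X 0)
    (hf : (DGCategory.Hom B X Y).d 0 1 (by norm_num) f = 0)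
    (ψ : (preTrEmbedding B).mapH0.obj Z ≅ B.formalCone f hf) (g : Y ⟶ Z)
    (h : Z ⟶ (shiftFunctor (H0 B) (1 : ℤ)).obj X),
    (preTrEmbedding B).mapH0.map g ≫ ψ.hom = B.coneIn f hf ∧
    (preTrEmbedding B).mapH0.map h ≫ (B.shiftIso 1 X).hom = ψ.hom ≫ B.coneOut f hf ∧
    Nonempty (T ≅ Pretriangulated.Triangle.mk (homMk B f hf) g h)

end H0

/-- A functor `F` between `k`-linear categories with shifts, endowed with classes `S`, `S'` of
distinguished triangles, is an equivalence of `k`-linear triangulated categories: it is a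
`k`-linear equivalence that commutes with the shifts up to natural isomorphisms which are such
that `F` sends distinguished triangles to distinguished triangles. -/
def IsTriangulatedEquivalence (k : Type w) [Field k] {C D : Type u} [Category.{u} C]
    [Category.{u} D] [Preadditive C] [Preadditive D] [Linear k C] [Linear k D] [HasShift C ℤ]
    [HasShift D ℤ] (S : Set (Pretriangulated.Triangle C)) (S' : Set (Pretriangulated.Triangle D))
    (F : C ⥤ D) : Prop :=
  F.IsEquivalence ∧ F.Additive ∧ F.Linear k ∧
    ∃ _ : F.CommShift ℤ, ∀ T ∈ S, F.mapTriangle.obj T ∈ S'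

/-- A DG enhancement `(B, e)` of a triangulated category `T`: a pre-triangulated DG category `B`
and an equivalence of triangulated categories `e : H⁰(B) ⥤ T`. -/
structure DGEnhancement (k : Type w) [Field k] (T : Type u) [Category.{u} T] [Preadditive T]
    [Linear k T] [HasZeroObject T] [HasShift T ℤ] [∀ n : ℤ, (shiftFunctor T n).Additive]
    [Pretriangulated T] where
  B : DGCategory.{w, u} k
  [isPreTriangulated : B.IsPreTriangulated]
  e : H0 B ⥤ T
  isTriangulatedEquivalence :
    IsTriangulatedEquivalence k (H0.distTriangles B) (Pretriangulated.distinguishedTriangles) e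

attribute [instance] DGEnhancement.isPreTriangulated

/-- `T` has a strongly unique DG enhancement: for any DG enhancements `(B, e)` and `(B', e')` there
is a quasi-functor `F : B ⟶ B'` such that `H⁰(F)` is an equivalence of triangulated categories and
`e ≅ e' ∘ H⁰(F)`. -/
def HasStronglyUniqueDGEnhancement (k : Type w) [Field k] (T : Type u) [Category.{u} T]
    [Preadditive T] [Linear k T] [HasZeroObject T] [HasShift T ℤ]
    [∀ n : ℤ, (shiftFunctor T n).Additive] [Pretriangulated T] : Prop :=
  ∀ E E' : DGEnhancement k T, ∃ (F : QuasiFunctor E.B E'.B) (G : H0 E.B ⥤ H0 E'.B),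
    F.Represents G ∧
    IsTriangulatedEquivalence k (H0.distTriangles E.B) (H0.distTriangles E'.B) G ∧
    Nonempty (E.e ≅ G ⋙ E'.e)

/-! Strong uniqueness supplies a quasi-functor from the first enhancement to the second, inducing on
homotopy categories an equivalence `G` compatible with `e₁` and `e₂`. If it were an honest DG
functor sending `B₁` to `B₂`, its action on `Hom(B₁, B₁)` would finish the proof. Two defects must
be repaired: a quasi-functor is only a word in DG functors and formal inverses, and `B₁` only goes
to an object isomorphic to `B₂` in the homotopy category.

One construction repairs both: the homotopy pullback of `F : A ⟶ C` and `G : B ⟶ C`, whose objects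
are pairs with a homotopy equivalence between their images. If `G` is a quasi-equivalence, the
projection to `A` is surjective on objects and a quasi-isomorphism on morphism complexes
(`fstFunctor_map_isQuasiIso`), and the square commutes up to isomorphism on `H⁰` (`mapH0Iso`). Hence
a formal inverse of `G` can be replaced by a roof. Induction over the morphisms of the localization
(`liftable_eq_top`) gives a roof `A ⟵ D ⟶ B` of DG functors `r`, `q` with `r` a surjective
quasi-equivalence and `H⁰(q) ≅ H⁰(r) ⋙ G` (`Hqe.exists_roof`). A second pullback, of `q` with the
identity of `B`, has an object lying over a preimage of `B₁` and over `B₂` exactly.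

The comparison with the quasi-functor is made only on `H⁰`, so the leg towards `B` is known to be an
equivalence only on homotopy categories. Since `A` is pre-triangulated, cohomology of degree `n` is
cohomology of degree `0` out of a shifted object, so the leg is a quasi-isomorphism on all morphism
complexes (`map_isQuasiIso_of_mapH0`). Endomorphisms of the chosen object then map
quasi-isomorphically to both DG algebras. -/

/-! ### Quasi-isomorphisms in terms of cocycles and boundaries -/

namespace DGModule

variable {k : Type w} [Field k]

namespace Hom

variable {M N P : DGModule.{w, u} k}

/-- Injectivity on cohomology, for elements. The neighbouring degrees are free variables, so that it
applies to degrees written in different ways. -/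
lemma IsQuasiIso.exists_d_eq {φ : Hom M N} (hφ : φ.IsQuasiIso) {l n m : ℤ} (hl : l + 1 = n)
    (hm : n + 1 = m) (x : M.X n) (hx : M.d n m hm x = 0) (y : N.X l)
    (hy : N.d l n hl y = φ.f n x) : ∃ x' : M.X l, M.d l n hl x' = x := by
  subst hm
  obtain rfl : l = n - 1 := by omega
  have h : φ.mapH n (Submodule.Quotient.mk ⟨x, hx⟩) = 0 :=
    (Submodule.Quotient.mk_eq_zero _).2 ⟨y, hy⟩
  obtain ⟨x', hx'⟩ := (Submodule.Quotient.mk_eq_zero _).1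
    ((hφ n).1 (h.trans (map_zero (φ.mapH n)).symm))
  exact ⟨x', hx'⟩

lemma IsQuasiIso.exists_cocycle {φ : Hom M N} (hφ : φ.IsQuasiIso) {l n m : ℤ} (hl : l + 1 = n)
    (hm : n + 1 = m) (y : N.X n) (hy : N.d n m hm y = 0) :
    ∃ x : M.X n, M.d n m hm x = 0 ∧ ∃ z : N.X l, N.d l n hl z = φ.f n x - y := by
  subst hm
  obtain rfl : l = n - 1 := by omega
  obtain ⟨x, hx⟩ := (hφ n).2 (Submodule.Quotient.mk ⟨y, hy⟩)
  obtain ⟨⟨x, hx'⟩, rfl⟩ := Submodule.Quotient.mk_surjective _ x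
  obtain ⟨z, hz⟩ := (Submodule.Quotient.eq _).1 hx
  exact ⟨x, hx', z, hz⟩

/-- Surjectivity is asked on cocycles themselves, not only modulo boundaries: this is what a
projection of a homotopy pullback provides. -/
lemma isQuasiIso_of_exists (φ : Hom M N)
    (h₁ : ∀ (n : ℤ) (x : M.X n), M.d n (n + 1) rfl x = 0 → ∀ y : N.X (n - 1),
      N.d (n - 1) n (by omega) y = φ.f n x → ∃ x' : M.X (n - 1), M.d (n - 1) n (by omega) x' = x)
    (h₂ : ∀ (n : ℤ) (y : N.X n), N.d n (n + 1) rfl y = 0 →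
      ∃ x : M.X n, M.d n (n + 1) rfl x = 0 ∧ φ.f n x = y) : φ.IsQuasiIso := by
  intro n
  refine ⟨(injective_iff_map_eq_zero _).2 fun x hx => ?_, fun y => ?_⟩
  · obtain ⟨⟨x, hx'⟩, rfl⟩ := Submodule.Quotient.mk_surjective _ x
    obtain ⟨y, hy⟩ := (Submodule.Quotient.mk_eq_zero _).1 hx
    obtain ⟨x', h⟩ := h₁ n x hx' y hy
    exact (Submodule.Quotient.mk_eq_zero _).2 ⟨x', h⟩
  · obtain ⟨⟨y, hy⟩, rfl⟩ := Submodule.Quotient.mk_surjective _ y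
    obtain ⟨x, hx, rfl⟩ := h₂ n y hy
    exact ⟨Submodule.Quotient.mk ⟨x, hx⟩, rfl⟩

/-- The composition of morphisms of DG modules. -/
def comp (φ : Hom M N) (ψ : Hom N P) : Hom M P where
  f i := ψ.f i ∘ₗ φ.f i
  comm i j h x := by simp [φ.comm, ψ.comm]

lemma mapH_comp (φ : Hom M N) (ψ : Hom N P) (n : ℤ) (x : M.H n) :
    (φ.comp ψ).mapH n x = ψ.mapH n (φ.mapH n x) := by
  obtain ⟨x, rfl⟩ := Submodule.Quotient.mk_surjective _ x
  rfl

lemma IsQuasiIso.comp {φ : Hom M N} {ψ : Hom N P} (hφ : φ.IsQuasiIso) (hψ : ψ.IsQuasiIso) :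
    (φ.comp ψ).IsQuasiIso := fun n => by
  have h := (hψ n).comp (hφ n)
  rwa [show ψ.mapH n ∘ φ.mapH n = (φ.comp ψ).mapH n from
    funext fun x => (mapH_comp φ ψ n x).symm] at h

end Hom

end DGModule

/-! ### Precomposition with a homotopy equivalence -/

namespace DGCategory

variable {k : Type w} [Field k] (B : DGCategory.{w, u} k)

/-- Precomposition with a closed morphism of degree `0`. -/
def precomp {X Y : B.Obj} (φ : (B.Hom X Y).X 0) (hφ : (B.Hom X Y).d 0 1 (by norm_num) φ = 0)
    (Z : B.Obj) : DGModule.Hom (B.Hom Y Z) (B.Hom X Z) where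
  f i := B.comp 0 i i (by omega) φ
  comm i j h x := by
    rw [B.leibniz 0 i i 1 j j (by omega) (by norm_num) h h, hφ]
    simp

lemma precomp_mapH {X Y : B.Obj} (φ : (B.Hom X Y).X 0)
    (hφ : (B.Hom X Y).d 0 1 (by norm_num) φ = 0) (Z : B.Obj) (n : ℤ) (x : (B.Hom Y Z).H n) :
    (B.precomp φ hφ Z).mapH n x = B.compH 0 n n (by omega) (H0.homMk B φ hφ) x := by
  obtain ⟨x, rfl⟩ := Submodule.Quotient.mk_surjective _ x
  rfl

/-- On cohomology the inverse is composition with the inverse class of `φ` in `H⁰`, by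
associativity. -/
lemma precomp_isQuasiIso {X Y : B.Obj} (φ : (B.Hom X Y).X 0)
    (hφ : (B.Hom X Y).d 0 1 (by norm_num) φ = 0) [IsIso (H0.homMk B φ hφ)] (Z : B.Obj) :
    (B.precomp φ hφ Z).IsQuasiIso := by
  intro n
  rw [Function.bijective_iff_has_inverse]
  have h₁ : B.compH 0 0 0 (by omega) (H0.homMk B φ hφ) (inv (H0.homMk B φ hφ)) = B.idH X :=
    IsIso.hom_inv_id (H0.homMk B φ hφ)
  have h₂ : B.compH 0 0 0 (by omega) (inv (H0.homMk B φ hφ)) (H0.homMk B φ hφ) = B.idH Y :=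
    IsIso.inv_hom_id (H0.homMk B φ hφ)
  refine ⟨B.compH 0 n n (by omega) (inv (H0.homMk B φ hφ)), fun x => ?_, fun x => ?_⟩
  · rw [precomp_mapH, ← B.assocH 0 0 n 0 n n (by omega) (by omega) (by omega), h₂, B.idH_comp]
  · rw [precomp_mapH, ← B.assocH 0 0 n 0 n n (by omega) (by omega) (by omega), h₁, B.idH_comp]

end DGCategory

/-! ### The homotopy pullback as a DG category -/

section

variable {k : Type w} [Field k] {A B C : DGCategory.{w, u} k}

/-- The objects of the homotopy pullback of the DG functors `F : A ⟶ C` and `G : B ⟶ C`: pairs of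
objects of `A` and `B` with a homotopy equivalence between their images in `C`. -/
structure HoPullback (F : DGFunctor A C) (G : DGFunctor B C) where
  fst : A.Obj
  snd : B.Obj
  φ : (C.Hom (F.obj fst) (G.obj snd)).X 0
  d_φ : (C.Hom (F.obj fst) (G.obj snd)).d 0 1 (by norm_num) φ = 0
  isIso : IsIso (H0.homMk C φ d_φ)

namespace HoPullback

variable {F : DGFunctor A C} {G : DGFunctor B C}

/-- The morphisms of degree `n` of the homotopy pullback: triples `(f, g, h)` with `f`, `g` of
degree `n` in `A`, `B` and `h` of degree `n - 1` in `C`. -/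
abbrev Mor (P Q : HoPullback F G) (n : ℤ) : Type u :=
  (A.Hom P.fst Q.fst).X n × (B.Hom P.snd Q.snd).X n ×
    (C.Hom (F.obj P.fst) (G.obj Q.snd)).X (n - 1)

/-- The differential `d (f, g, h) = (d f, d g, f φ' - φ g - d h)`. -/
def dₗ (P Q : HoPullback F G) (n m : ℤ) (hnm : n + 1 = m) : Mor P Q n →ₗ[k] Mor P Q m where
  toFun x :=
    ((A.Hom P.fst Q.fst).d n m hnm x.1, (B.Hom P.snd Q.snd).d n m hnm x.2.1,
      C.comp n 0 (m - 1) (by omega) ((F.map P.fst Q.fst).f n x.1) Q.φ -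
        C.comp 0 n (m - 1) (by omega) P.φ ((G.map P.snd Q.snd).f n x.2.1) -
        (C.Hom (F.obj P.fst) (G.obj Q.snd)).d (n - 1) (m - 1) (by omega) x.2.2)
  map_add' x y := by
    refine Prod.ext (by simp) (Prod.ext (by simp) ?_)
    simp only [Prod.fst_add, Prod.snd_add, map_add, LinearMap.add_apply]
    abel
  map_smul' c x := by
    refine Prod.ext (by simp) (Prod.ext (by simp) ?_)
    simp only [Prod.smul_fst, Prod.smul_snd, map_smul, LinearMap.smul_apply, RingHom.id_apply,
      smul_sub]

lemma dₗ_apply (P Q : HoPullback F G) (n m : ℤ) (hnm : n + 1 = m) (x : Mor P Q n) :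
    dₗ P Q n m hnm x =
      ((A.Hom P.fst Q.fst).d n m hnm x.1, (B.Hom P.snd Q.snd).d n m hnm x.2.1,
        C.comp n 0 (m - 1) (by omega) ((F.map P.fst Q.fst).f n x.1) Q.φ -
          C.comp 0 n (m - 1) (by omega) P.φ ((G.map P.snd Q.snd).f n x.2.1) -
          (C.Hom (F.obj P.fst) (G.obj Q.snd)).d (n - 1) (m - 1) (by omega) x.2.2) := rfl

/-- Because `P.φ` and `Q.φ` are closed, differentiating `f φ' - φ g` gives `(d f) φ' - φ (d g)`,
which cancels against the terms coming from `d f` and `d g`. -/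
lemma dₗ_dₗ (P Q : HoPullback F G) (n m l : ℤ) (hnm : n + 1 = m) (hml : m + 1 = l)
    (x : Mor P Q n) : dₗ P Q m l hml (dₗ P Q n m hnm x) = 0 := by
  refine Prod.ext (DGModule.d_d _ _ _ _ _ _ _) (Prod.ext (DGModule.d_d _ _ _ _ _ _ _) ?_)
  simp only [dₗ_apply, Prod.snd_zero, map_sub, DGModule.d_d, sub_zero]
  rw [C.leibniz n 0 (m - 1) m 1 (l - 1) (by omega) hnm (by norm_num) (by omega), Q.d_φ,
    C.leibniz 0 n (m - 1) 1 m (l - 1) (by omega) (by norm_num) hnm (by omega), P.d_φ,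
    (F.map _ _).comm, (G.map _ _).comm]
  simp

/-- The complex of morphisms of the homotopy pullback. -/
def homComplex (P Q : HoPullback F G) : DGModule.{w, u} k where
  X := Mor P Q
  d := dₗ P Q
  d_d := dₗ_dₗ P Q

/-- Composition in the homotopy pullback. -/
def compₗ {P Q R : HoPullback F G} (m n l : ℤ) (hl : m + n = l) :
    Mor P Q m →ₗ[k] Mor Q R n →ₗ[k] Mor P R l :=
  LinearMap.mk₂ k
    (fun x y => (A.comp m n l hl x.1 y.1, B.comp m n l hl x.2.1 y.2.1,
      (m.negOnePow : ℤ) • C.comp m (n - 1) (l - 1) (by omega) ((F.map _ _).f m x.1) y.2.2 +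
        C.comp (m - 1) n (l - 1) (by omega) x.2.2 ((G.map _ _).f n y.2.1)))
    (fun x x' y => by
      refine Prod.ext (LinearMap.map_add₂ _ _ _ _) (Prod.ext (LinearMap.map_add₂ _ _ _ _) ?_)
      simp only [Prod.fst_add, Prod.snd_add, map_add, LinearMap.add_apply, smul_add]
      abel)
    (fun c x y => by
      refine Prod.ext (LinearMap.map_smul₂ _ _ _ _) (Prod.ext (LinearMap.map_smul₂ _ _ _ _) ?_)
      simp only [Prod.smul_fst, Prod.smul_snd, map_smul, LinearMap.smul_apply, smul_add]
      rw [smul_comm])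
    (fun x y y' => by
      refine Prod.ext (map_add _ _ _) (Prod.ext (map_add _ _ _) ?_)
      simp only [Prod.fst_add, Prod.snd_add, map_add, smul_add]
      abel)
    (fun c x y => by
      refine Prod.ext (map_smul _ _ _) (Prod.ext (map_smul _ _ _) ?_)
      simp only [Prod.smul_fst, Prod.smul_snd, map_smul, smul_add]
      rw [smul_comm])

lemma compₗ_apply {P Q R : HoPullback F G} (m n l : ℤ) (hl : m + n = l)
    (x : Mor P Q m) (y : Mor Q R n) :
    compₗ m n l hl x y = (A.comp m n l hl x.1 y.1, B.comp m n l hl x.2.1 y.2.1,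
      (m.negOnePow : ℤ) • C.comp m (n - 1) (l - 1) (by omega) ((F.map _ _).f m x.1) y.2.2 +
        C.comp (m - 1) n (l - 1) (by omega) x.2.2 ((G.map _ _).f n y.2.1)) := rfl

/-- In the third component the mixed term `f φ' g'` appears once in each summand on the right, with
opposite signs; the sign `(-1)ᵐ` in `compₗ` is chosen for this. What remains is the Leibniz rule in
`C` for `f s'` and `s g'`. -/
lemma dₗ_compₗ {P Q R : HoPullback F G} (i j n i' j' n' : ℤ) (h : i + j = n) (hi : i + 1 = i')
    (hj : j + 1 = j') (hn : n + 1 = n') (h₁ : i' + j = n') (h₂ : i + j' = n') (x : Mor P Q i)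
    (y : Mor Q R j) :
    dₗ P R n n' hn (compₗ i j n h x y) =
      compₗ i' j n' h₁ (dₗ P Q i i' hi x) y +
        (i.negOnePow : ℤ) • compₗ i j' n' h₂ x (dₗ Q R j j' hj y) := by
  obtain ⟨f, g, s⟩ := x
  obtain ⟨f', g', s'⟩ := y
  have a₁ := C.assoc i j 0 n (j' - 1) (n' - 1) (by omega) (by omega) (by omega)
    ((F.map _ _).f i f) ((F.map _ _).f j f') R.φ
  have a₂ := C.assoc i 0 j (i' - 1) (j' - 1) (n' - 1) (by omega) (by omega) (by omega)
    ((F.map _ _).f i f) Q.φ ((G.map _ _).f j g')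
  have a₃ := C.assoc 0 i j (i' - 1) n (n' - 1) (by omega) (by omega) (by omega)
    P.φ ((G.map _ _).f i g) ((G.map _ _).f j g')
  have e₁ := C.leibniz i (j - 1) (n - 1) i' (j' - 1) (n' - 1) (by omega) hi (by omega) (by omega)
    ((F.map _ _).f i f) s'
  have e₂ := C.leibniz (i - 1) j (n - 1) (i' - 1) j' (n' - 1) (by omega) (by omega) hj (by omega)
    s ((G.map _ _).f j g')
  subst hi hj
  simp only [compₗ_apply, dₗ_apply]
  refine Prod.ext (A.leibniz _ _ _ _ _ _ _ _ _ _ _ _) (Prod.ext (B.leibniz _ _ _ _ _ _ _ _ _ _ _ _) ?_)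
  have hε : (((i - 1 : ℤ)).negOnePow : ℤ) = -(i.negOnePow : ℤ) := by
    rw [Int.negOnePow_sub]; simp
  have hε' : (((i + 1 : ℤ)).negOnePow : ℤ) = -(i.negOnePow : ℤ) := by
    rw [Int.negOnePow_add]; simp
  rw [hε] at e₂
  simp only [Prod.snd_add, Prod.smul_snd, map_add, map_sub, map_zsmul, LinearMap.sub_apply,
    F.map_comp i j n h, G.map_comp i j n h, hε', a₁, ← a₃, a₂, e₁, e₂, (F.map _ _).comm,
    (G.map _ _).comm,
    smul_add, smul_sub, smul_smul, neg_smul, negOnePow_mul_self, one_smul]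
  abel

lemma dₗ_id (P : HoPullback F G) :
    dₗ P P 0 1 (by norm_num) (A.id P.fst, B.id P.snd, 0) = 0 := by
  refine Prod.ext (A.d_id _) (Prod.ext (B.d_id _) ?_)
  simp only [dₗ_apply, F.map_id, G.map_id, map_zero, Prod.snd_zero]
  rw [sub_zero, sub_eq_zero]
  exact (C.id_comp 0 P.φ).trans (C.comp_id 0 P.φ).symm

lemma id_compₗ {P Q : HoPullback F G} (i : ℤ) (h : 0 + i = i) (x : Mor P Q i) :
    compₗ 0 i i h ((A.id P.fst, B.id P.snd, 0) : Mor P P 0) x = x := by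
  refine Prod.ext (A.id_comp _ _) (Prod.ext (B.id_comp _ _) ?_)
  simp only [compₗ_apply, F.map_id, map_zero, LinearMap.zero_apply, add_zero,
    Int.negOnePow_zero, Units.val_one, one_smul]
  exact C.id_comp _ _

lemma compₗ_id {P Q : HoPullback F G} (i : ℤ) (h : i + 0 = i) (x : Mor P Q i) :
    compₗ i 0 i h x ((A.id Q.fst, B.id Q.snd, 0) : Mor Q Q 0) = x := by
  refine Prod.ext (A.comp_id _ _) (Prod.ext (B.comp_id _ _) ?_)
  simp only [compₗ_apply, G.map_id, map_zero, smul_zero, zero_add]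
  exact C.comp_id _ _

lemma compₗ_assoc {P Q R S : HoPullback F G} (i j l ij jl n : ℤ) (hij : i + j = ij)
    (hjl : j + l = jl) (h : ij + l = n) (h' : i + jl = n) (x : Mor P Q i) (y : Mor Q R j)
    (z : Mor R S l) :
    compₗ ij l n h (compₗ i j ij hij x y) z = compₗ i jl n h' x (compₗ j l jl hjl y z) := by
  have hε : (ij.negOnePow : ℤ) = (i.negOnePow : ℤ) * (j.negOnePow : ℤ) := by
    rw [← hij, Int.negOnePow_add, Units.val_mul]
  refine Prod.ext (A.assoc _ _ _ _ _ _ _ _ _ _ _ _)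
    (Prod.ext (B.assoc _ _ _ _ _ _ _ _ _ _ _ _) ?_)
  simp only [compₗ_apply, F.map_comp i j ij hij, G.map_comp j l jl hjl, map_add, map_zsmul,
    LinearMap.add_apply, LinearMap.smul_apply, smul_add, smul_smul]
  rw [C.assoc i j (l - 1) ij (jl - 1) (n - 1) hij (by omega) (by omega),
    C.assoc i (j - 1) l (ij - 1) (jl - 1) (n - 1) (by omega) (by omega) (by omega),
    C.assoc (i - 1) j l (ij - 1) jl (n - 1) (by omega) (by omega) (by omega), add_assoc, hε]

end HoPullback

open HoPullback in
/-- The homotopy pullback of DG categories. -/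
def hoPullback (F : DGFunctor A C) (G : DGFunctor B C) : DGCategory.{w, u} k where
  Obj := HoPullback F G
  Hom := homComplex
  id P := ((A.id P.fst, B.id P.snd, 0) : Mor P P 0)
  comp m n l hl := compₗ m n l hl
  d_id := dₗ_id
  leibniz i j n i' j' n' h hi hj hn x y :=
    dₗ_compₗ i j n i' j' n' h hi hj hn (by omega) (by omega) x y
  id_comp i x := id_compₗ i (by omega) x
  comp_id i x := compₗ_id i (by omega) x
  assoc i j l ij jl n hij hjl h x y z := compₗ_assoc i j l ij jl n hij hjl h (by omega) x y z

end

/-! ### The projections of the homotopy pullback -/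

namespace HoPullback

variable {k : Type w} [Field k] {A B C : DGCategory.{w, u} k} (F : DGFunctor A C)
  (G : DGFunctor B C)

/-- The first projection of the homotopy pullback. -/
def fstFunctor : DGFunctor (hoPullback F G) A where
  obj P := P.fst
  map P Q :=
    { f := fun n => (LinearMap.fst k _ _ : Mor P Q n →ₗ[k] (A.Hom P.fst Q.fst).X n)
      comm := fun _ _ _ _ => rfl }
  map_id _ := rfl
  map_comp _ _ _ _ _ _ := rfl

/-- The second projection of the homotopy pullback. -/
def sndFunctor : DGFunctor (hoPullback F G) B where
  obj P := P.snd
  map P Q :=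
    { f := fun n => (LinearMap.fst k _ _ ∘ₗ LinearMap.snd k _ _ :
        Mor P Q n →ₗ[k] (B.Hom P.snd Q.snd).X n)
      comm := fun _ _ _ _ => rfl }
  map_id _ := rfl
  map_comp _ _ _ _ _ _ := rfl

variable {F G}

/-- The map `g ↦ φ G(g)` is a quasi-isomorphism, being `G` followed by precomposition with a
homotopy equivalence. The degree `p` is a second name for `n`, because third components of
differentials live in degree `n + 1 - 1`. -/
lemma exists_d_eq_of_comp (hG : ∀ X Y : B.Obj, (G.map X Y).IsQuasiIso) (P : HoPullback F G)
    (Y : B.Obj) {l n m p : ℤ} (hl : l + 1 = n) (hm : n + 1 = m) (hp : p = n)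
    (g : (B.Hom P.snd Y).X n) (hg : (B.Hom P.snd Y).d n m hm g = 0)
    (y : (C.Hom (F.obj P.fst) (G.obj Y)).X l)
    (hy : (C.Hom (F.obj P.fst) (G.obj Y)).d l p (by omega) y =
      C.comp 0 n p (by omega) P.φ ((G.map P.snd Y).f n g)) :
    ∃ g', (B.Hom P.snd Y).d l n hl g' = g := by
  subst hp
  have := P.isIso
  exact ((hG P.snd Y).comp (C.precomp_isQuasiIso P.φ P.d_φ (G.obj Y))).exists_d_eq hl hm g hg y hy

lemma exists_cocycle_of_comp (hG : ∀ X Y : B.Obj, (G.map X Y).IsQuasiIso) (P : HoPullback F G)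
    (Y : B.Obj) {l n m p q : ℤ} (hl : l + 1 = n) (hm : n + 1 = m) (hp : p = n) (hq : p + 1 = q)
    (y : (C.Hom (F.obj P.fst) (G.obj Y)).X p)
    (hy : (C.Hom (F.obj P.fst) (G.obj Y)).d p q hq y = 0) :
    ∃ g, (B.Hom P.snd Y).d n m hm g = 0 ∧
      ∃ z, (C.Hom (F.obj P.fst) (G.obj Y)).d l p (by omega) z =
        C.comp 0 n p (by omega) P.φ ((G.map P.snd Y).f n g) - y := by
  subst hp
  obtain rfl : m = q := by omega
  have := P.isIso
  exact ((hG P.snd Y).comp (C.precomp_isQuasiIso P.φ P.d_φ (G.obj Y))).exists_cocycle hl hm y hy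

/-- The kernel of the projection consists of the pairs `(g, h)` and is, up to shift and signs, the
cone of the quasi-isomorphism `g ↦ φ G(g)`, hence acyclic. The proof carries this out on elements,
writing below `φ_P`, `φ_Q` for the equivalences of `P`, `Q`. -/
lemma fstFunctor_map_isQuasiIso (hG : ∀ X Y : B.Obj, (G.map X Y).IsQuasiIso)
    (P Q : HoPullback F G) : ((fstFunctor F G).map P Q).IsQuasiIso := by
  refine DGModule.Hom.isQuasiIso_of_exists _ ?_ ?_
  · rintro n ⟨f, g, h⟩ hx (e : (A.Hom P.fst Q.fst).X (n - 1))
      (he : (A.Hom P.fst Q.fst).d (n - 1) n (by omega) e = f)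
    have hx' : dₗ P Q n (n + 1) rfl (f, g, h) = 0 := hx
    have hg : (B.Hom P.snd Q.snd).d n (n + 1) rfl g = 0 := congrArg (fun x => x.2.1) hx'
    have hh : C.comp n 0 (n + 1 - 1) (by omega) ((F.map P.fst Q.fst).f n f) Q.φ -
        C.comp 0 n (n + 1 - 1) (by omega) P.φ ((G.map P.snd Q.snd).f n g) -
        (C.Hom (F.obj P.fst) (G.obj Q.snd)).d (n - 1) (n + 1 - 1) (by omega) h = 0 :=
      congrArg (fun x => x.2.2) hx'
    have hd : (C.Hom (F.obj P.fst) (G.obj Q.snd)).d (n - 1) (n + 1 - 1) (by omega)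
        (C.comp (n - 1) 0 (n - 1) (by omega) ((F.map P.fst Q.fst).f (n - 1) e) Q.φ) =
        C.comp n 0 (n + 1 - 1) (by omega) ((F.map P.fst Q.fst).f n f) Q.φ := by
      rw [C.leibniz (n - 1) 0 (n - 1) n 1 (n + 1 - 1) (by omega) (by omega) (by norm_num)
        (by omega), Q.d_φ, ← (F.map _ _).comm, he]
      simp
    -- Closedness of `(f, g, h)` and `f = d e` give `φ_P G(g) = d (F(e) φ_Q - h)`, so `g` is itself
    -- exact.
    obtain ⟨g', hg'⟩ := exists_d_eq_of_comp hG P Q.snd (l := n - 1) (p := n + 1 - 1) (by omega) rfl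
      (by omega) g hg (C.comp (n - 1) 0 (n - 1) (by omega)
        ((F.map P.fst Q.fst).f (n - 1) e) Q.φ - h) (by
        rw [map_sub, hd]
        rw [sub_eq_zero] at hh
        rw [← hh]
        abel)
    have hd' : (C.Hom (F.obj P.fst) (G.obj Q.snd)).d (n - 1) (n + 1 - 1) (by omega)
        (C.comp 0 (n - 1) (n - 1) (by omega) P.φ ((G.map P.snd Q.snd).f (n - 1) g')) =
        C.comp 0 n (n + 1 - 1) (by omega) P.φ ((G.map P.snd Q.snd).f n g) := by
      rw [C.leibniz 0 (n - 1) (n - 1) 1 n (n + 1 - 1) (by omega) (by norm_num) (by omega)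
        (by omega), P.d_φ, ← (G.map _ _).comm, hg']
      simp
    -- The primitive `g'` of `g` satisfies the third equation only up to the cocycle `F(e) φ_Q - φ_P
    -- G(g') - h`. This cocycle is `φ_P G(g'')` up to the boundary of `z`, so adding the closed
    -- element `g''` to `g'` corrects it.
    obtain ⟨g'', hg'', z, hz⟩ := exists_cocycle_of_comp hG P Q.snd (l := n - 1 - 1) (n := n - 1)
      (m := n) (p := n - 1) (q := n + 1 - 1) (by omega) (by omega) rfl (by omega)
      (C.comp (n - 1) 0 (n - 1) (by omega) ((F.map P.fst Q.fst).f (n - 1) e) Q.φ -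
        C.comp 0 (n - 1) (n - 1) (by omega) P.φ ((G.map P.snd Q.snd).f (n - 1) g') - h) (by
        rw [map_sub, map_sub, hd, hd', hh])
    refine ⟨(e, g' + g'', -z), Prod.ext he (Prod.ext ?_ ?_)⟩
    · exact (map_add _ _ _).trans (by rw [hg', hg'', add_zero])
    · change C.comp (n - 1) 0 (n - 1) _ ((F.map P.fst Q.fst).f (n - 1) e) Q.φ -
        C.comp 0 (n - 1) (n - 1) _ P.φ ((G.map P.snd Q.snd).f (n - 1) (g' + g'')) -
        (C.Hom (F.obj P.fst) (G.obj Q.snd)).d (n - 1 - 1) (n - 1) _ (-z) = h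
      rw [map_neg, hz, map_add, map_add]
      abel
  · intro n (f : (A.Hom P.fst Q.fst).X n) (hf : (A.Hom P.fst Q.fst).d n (n + 1) rfl f = 0)
    -- A closed `f` lifts once the cocycle `F(f) φ_Q` is cohomologous to some `φ_P G(g)` with `g`
    -- closed. The third entry is `-z` because `d h` enters the differential with a minus sign.
    obtain ⟨g, hg, z, hz⟩ := exists_cocycle_of_comp hG P Q.snd (l := n - 1) (n := n) (m := n + 1)
      (p := n + 1 - 1) (q := n + 1) (by omega) rfl (by omega) (by omega)
      (C.comp n 0 (n + 1 - 1) (by omega) ((F.map P.fst Q.fst).f n f) Q.φ) (by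
        rw [C.leibniz n 0 (n + 1 - 1) (n + 1) 1 (n + 1) (by omega) rfl (by norm_num)
          (by omega), Q.d_φ, ← (F.map _ _).comm, hf]
        simp)
    refine ⟨(f, g, -z), Prod.ext hf (Prod.ext hg ?_), rfl⟩
    change C.comp n 0 (n + 1 - 1) _ ((F.map P.fst Q.fst).f n f) Q.φ -
      C.comp 0 n (n + 1 - 1) _ P.φ ((G.map P.snd Q.snd).f n g) -
      (C.Hom (F.obj P.fst) (G.obj Q.snd)).d (n - 1) (n + 1 - 1) _ (-z) = 0
    rw [map_neg, hz]
    abel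

/-- Any closed representative of the isomorphism `e` serves as `φ`. The two components are
prescribed on the nose, which turns an isomorphism in `H⁰` into an object with given projections. -/
lemma exists_fst_snd_eq (X : A.Obj) (Y : B.Obj)
    (e : F.mapH0.obj X ≅ G.mapH0.obj Y) : ∃ P : HoPullback F G, P.fst = X ∧ P.snd = Y := by
  obtain ⟨⟨φ, hφ⟩, h⟩ := Submodule.Quotient.mk_surjective _ e.hom
  have h' : H0.homMk C φ hφ = e.hom := h
  exact ⟨⟨X, Y, φ, hφ, ⟨e.inv, (congrArg (· ≫ e.inv) h').trans e.hom_inv_id,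
    (congrArg (e.inv ≫ ·) h').trans e.inv_hom_id⟩⟩, rfl, rfl⟩

/-- The component of `mapH0Iso` at an object. -/
noncomputable def mapH0IsoApp (P : HoPullback F G) : F.mapH0.obj P.fst ≅ G.mapH0.obj P.snd where
  hom := H0.homMk C P.φ P.d_φ
  inv := P.isIso.out.choose
  hom_inv_id := P.isIso.out.choose_spec.1
  inv_hom_id := P.isIso.out.choose_spec.2

/-- The homotopy pullback square commutes up to isomorphism on homotopy categories. -/
noncomputable def mapH0Iso :
    (fstFunctor F G).mapH0 ⋙ F.mapH0 ≅ (sndFunctor F G).mapH0 ⋙ G.mapH0 :=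
  NatIso.ofComponents (fun P => mapH0IsoApp (F := F) (G := G) P) (by
    intro (P : HoPullback F G) (Q : HoPullback F G) x
    obtain ⟨⟨⟨f, g, h⟩, hx⟩, rfl⟩ := Submodule.Quotient.mk_surjective _ x
    have hf : (A.Hom P.fst Q.fst).d 0 (0 + 1) rfl f = 0 := congrArg (fun x => x.1) hx
    have hg : (B.Hom P.snd Q.snd).d 0 (0 + 1) rfl g = 0 := congrArg (fun x => x.2.1) hx
    have hx' : C.comp 0 0 0 (by norm_num) ((F.map P.fst Q.fst).f 0 f) Q.φ -
        C.comp 0 0 0 (by norm_num) P.φ ((G.map P.snd Q.snd).f 0 g) -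
        (C.Hom (F.obj P.fst) (G.obj Q.snd)).d (0 - 1) 0 (by norm_num) h = 0 :=
      congrArg (fun x => x.2.2) hx
    -- For a closed morphism `(f, g, h)`, the component `h` is a homotopy between the two ways
    -- around the naturality square.
    have key : (Submodule.Quotient.mk (C.compCocycles 0 0 0 (by norm_num)
        ((F.map P.fst Q.fst).mapCocycles 0 ⟨f, hf⟩) ⟨Q.φ, Q.d_φ⟩) :
          (C.Hom (F.obj P.fst) (G.obj Q.snd)).H 0) =
        Submodule.Quotient.mk (C.compCocycles 0 0 0 (by norm_num) ⟨P.φ, P.d_φ⟩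
          ((G.map P.snd Q.snd).mapCocycles 0 ⟨g, hg⟩)) :=
      (Submodule.Quotient.eq _).2 ⟨h, (sub_eq_zero.1 hx').symm⟩
    exact key)

end HoPullback

/-! ### Surjective quasi-equivalences and induced maps on cohomology -/

namespace DGFunctor

variable {k : Type w} [Field k]

/-- A DG functor that is surjective on objects and a quasi-isomorphism on morphism complexes. -/
structure IsSurjectiveQuasiEquivalence {A B : DGCategory.{w, u} k} (F : DGFunctor A B) :
    Prop where
  map_isQuasiIso : ∀ X Y : A.Obj, (F.map X Y).IsQuasiIso
  obj_surjective : Function.Surjective F.obj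

lemma IsSurjectiveQuasiEquivalence.comp {A B C : DGCategory.{w, u} k} {F : DGFunctor A B}
    {G : DGFunctor B C} (hF : F.IsSurjectiveQuasiEquivalence)
    (hG : G.IsSurjectiveQuasiEquivalence) : (F.comp G).IsSurjectiveQuasiEquivalence where
  map_isQuasiIso X Y := (hF.map_isQuasiIso X Y).comp (hG.map_isQuasiIso _ _)
  obj_surjective := hG.obj_surjective.comp hF.obj_surjective

lemma id_map_isQuasiIso (A : DGCategory.{w, u} k) (X Y : A.Obj) :
    ((DGFunctor.id A).map X Y).IsQuasiIso := fun n => by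
  have h : ⇑(((DGFunctor.id A).map X Y).mapH n) = _root_.id := by
    funext x
    obtain ⟨x, rfl⟩ := Submodule.Quotient.mk_surjective _ x
    rfl
  rw [h]
  exact Function.bijective_id

lemma id_isSurjectiveQuasiEquivalence (A : DGCategory.{w, u} k) :
    (DGFunctor.id A).IsSurjectiveQuasiEquivalence :=
  ⟨id_map_isQuasiIso A, fun X => ⟨X, rfl⟩⟩

lemma IsSurjectiveQuasiEquivalence.mapH0_isEquivalence {A B : DGCategory.{w, u} k}
    {F : DGFunctor A B} (hF : F.IsSurjectiveQuasiEquivalence) : F.mapH0.IsEquivalence where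
  faithful := ⟨fun h => (hF.map_isQuasiIso _ _ 0).1 h⟩
  full := ⟨fun f => (hF.map_isQuasiIso _ _ 0).2 f⟩
  essSurj := ⟨fun Y => by
    obtain ⟨X, rfl⟩ := hF.obj_surjective Y
    exact ⟨X, ⟨Iso.refl _⟩⟩⟩

lemma mapH_compH {A B : DGCategory.{w, u} k} (F : DGFunctor A B) {X Y Z : A.Obj} (i j n : ℤ)
    (h : i + j = n) (f : (A.Hom X Y).H i) (g : (A.Hom Y Z).H j) :
    (F.map X Z).mapH n (A.compH i j n h f g) =
      B.compH i j n h ((F.map X Y).mapH i f) ((F.map Y Z).mapH j g) := by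
  obtain ⟨f, rfl⟩ := Submodule.Quotient.mk_surjective _ f
  obtain ⟨g, rfl⟩ := Submodule.Quotient.mk_surjective _ g
  exact congrArg Submodule.Quotient.mk (Subtype.ext (F.map_comp i j n h f.1 g.1))

lemma mapH_idH {A B : DGCategory.{w, u} k} (F : DGFunctor A B) (X : A.Obj) :
    (F.map X X).mapH 0 (A.idH X) = B.idH (F.obj X) :=
  congrArg Submodule.Quotient.mk (Subtype.ext (F.map_id X))

end DGFunctor

/-! ### Shifts, and passing from degree zero to all degrees -/

namespace DGCategory

variable {k : Type w} [Field k]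

/-- `Y` is a shift of `X` in the graded homotopy category: there are mutually inverse classes
`Y ⟶ X` of degree `-n` and `X ⟶ Y` of degree `n`. -/
def IsShiftOf (A : DGCategory.{w, u} k) (n : ℤ) (Y X : A.Obj) : Prop :=
  ∃ (α : (A.Hom Y X).H (-n)) (β : (A.Hom X Y).H n),
    A.compH (-n) n 0 (by omega) α β = A.idH Y ∧ A.compH n (-n) 0 (by omega) β α = A.idH X

lemma exists_isShiftOf (A : DGCategory.{w, u} k) [A.IsPreTriangulated] (n : ℤ) (X : A.Obj) :
    ∃ Y, A.IsShiftOf n Y X := by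
  -- The class from `Y` to `X` must have degree `-n`, so `Y` is the shift of `X` by `-n`.
  have h₁ := (H0.shiftGr A (-n) X).hom_inv_id
  have h₂ := (H0.shiftGr A (-n) X).inv_hom_id
  have e₁ := H0.shiftGr_hom_fst A (-n) X
  have e₂ := (H0.shiftGr_inv_fst A (-n) X).trans (neg_neg n)
  -- With the two homogeneous classes made variables, their degrees can be substituted away and no
  -- transport is left.
  generalize (H0.shiftGr A (-n) X).hom = α at h₁ h₂ e₁
  generalize (H0.shiftGr A (-n) X).inv = β at h₁ h₂ e₂
  obtain ⟨a, α⟩ := α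
  obtain ⟨b, β⟩ := β
  dsimp only at e₁ e₂
  subst e₁ e₂
  have h₁' := (GrH.comp_mk A (-b) b 0 (by omega) α β).symm.trans h₁
  have h₂' := (GrH.comp_mk A b (-b) 0 (by omega) β α).symm.trans h₂
  exact ⟨H0.shiftOb A (-b) X, α, β, eq_of_heq (Sigma.mk.inj h₁').2, eq_of_heq (Sigma.mk.inj h₂').2⟩

/-- Full faithfulness on graded cohomology lifts both classes, and faithfulness in degree `0`
reflects the two identities. -/
lemma IsShiftOf.of_map {A B : DGCategory.{w, u} k} {F : DGFunctor A B}
    (hF : ∀ X Y : A.Obj, (F.map X Y).IsQuasiIso) {n : ℤ} {Y X : A.Obj}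
    (h : B.IsShiftOf n (F.obj Y) (F.obj X)) : A.IsShiftOf n Y X := by
  obtain ⟨α, β, h₁, h₂⟩ := h
  obtain ⟨α, rfl⟩ := (hF Y X _).2 α
  obtain ⟨β, rfl⟩ := (hF X Y _).2 β
  refine ⟨α, β, (hF Y Y 0).1 ?_, (hF X X 0).1 ?_⟩
  · rw [F.mapH_compH, F.mapH_idH, h₁]
  · rw [F.mapH_compH, F.mapH_idH, h₂]

end DGCategory

namespace DGFunctor

variable {k : Type w} [Field k]

/-- Composition with `α` identifies `Hⁿ(Hom X Z)` with `H⁰(Hom Y Z)`, with inverse composition with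
`β`, and `F` respects these identifications. -/
lemma mapH_bijective_of_isShiftOf {A B : DGCategory.{w, u} k} (F : DGFunctor A B) {n : ℤ}
    {X Y Z : A.Obj} (h : A.IsShiftOf n Y X)
    (hF : Function.Bijective ((F.map Y Z).mapH 0)) :
    Function.Bijective ((F.map X Z).mapH n) := by
  obtain ⟨α, β, h₁, h₂⟩ := h
  refine ⟨fun x x' hx => ?_, fun y => ?_⟩
  · have h₃ : A.compH (-n) n 0 (by omega) α x = A.compH (-n) n 0 (by omega) α x' :=
      hF.1 (by rw [F.mapH_compH, F.mapH_compH, hx])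
    have h₄ := congrArg (A.compH n 0 n (by omega) β) h₃
    rwa [← A.assocH n (-n) n 0 0 n (by omega) (by omega) (by omega) (by omega),
      ← A.assocH n (-n) n 0 0 n (by omega) (by omega) (by omega) (by omega), h₂,
      A.idH_comp, A.idH_comp] at h₄
  · obtain ⟨z, hz⟩ := hF.2 (B.compH (-n) n 0 (by omega) ((F.map Y X).mapH (-n) α) y)
    refine ⟨A.compH n 0 n (by omega) β z, ?_⟩
    rw [F.mapH_compH, hz, ← B.assocH n (-n) n 0 0 n (by omega) (by omega) (by omega) (by omega),
      ← F.mapH_compH, h₂, F.mapH_idH, B.idH_comp]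

/-- If `A` is quasi-equivalent to a pre-triangulated DG category, a DG functor from `A` inducing an
equivalence of homotopy categories is a quasi-isomorphism on morphism complexes. -/
lemma map_isQuasiIso_of_mapH0 {A B C : DGCategory.{w, u} k} [C.IsPreTriangulated]
    {R : DGFunctor A C} (hR : R.IsSurjectiveQuasiEquivalence) (F : DGFunctor A B)
    [F.mapH0.IsEquivalence] (X Y : A.Obj) : (F.map X Y).IsQuasiIso := fun n => by
  -- The shifted object exists in `C`. Surjectivity of `R` on objects brings it to `A`, and `of_map`
  -- shows that it is still a shift there.
  obtain ⟨Z, hZ⟩ := C.exists_isShiftOf n (R.obj X)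
  obtain ⟨Z, rfl⟩ := hR.obj_surjective Z
  exact F.mapH_bijective_of_isShiftOf (DGCategory.IsShiftOf.of_map hR.map_isQuasiIso hZ)
    ⟨fun _ _ h => F.mapH0.map_injective (X := (show H0 A from Z)) (Y := (show H0 A from Y)) h,
      fun f => F.mapH0.map_surjective (X := (show H0 A from Z)) (Y := (show H0 A from Y)) f⟩

lemma isQuasiIso_endAlgebra {A B : DGCategory.{w, u} k} (F : DGFunctor A B) (X : A.Obj)
    (h : (F.map X X).IsQuasiIso) : ∃ φ : DGAlgebra.Hom (A.endAlgebra X) (B.endAlgebra (F.obj X)),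
      φ.toHom.IsQuasiIso :=
  ⟨{ toHom := F.map X X
     map_one := F.map_id X
     map_mul := F.map_comp }, h⟩

end DGFunctor

namespace HoPullback

variable {k : Type w} [Field k] {A B C : DGCategory.{w, u} k} (F : DGFunctor A C)
  (G : DGFunctor B C)

/-- Essential surjectivity of `H⁰(G)` supplies, for each `X`, a partner in `B` whose image is
isomorphic to that of `X`; this gives strict surjectivity on objects. -/
lemma fstFunctor_isSurjectiveQuasiEquivalence (hG : G.IsQuasiEquivalence) :
    (fstFunctor F G).IsSurjectiveQuasiEquivalence where
  map_isQuasiIso := fstFunctor_map_isQuasiIso hG.1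
  obj_surjective X := by
    have := hG.2
    obtain ⟨P, hP, -⟩ := exists_fst_snd_eq (F := F) (G := G) X _
      (G.mapH0.objObjPreimageIso (F.mapH0.obj X)).symm
    exact ⟨P, hP⟩

end HoPullback

/-! ### Representing morphisms of the localization by roofs -/

namespace HoCat

/-- In `liftable_wInv`, the square is the homotopy pullback square, and `w` is the class induced by
the formal inverse of the quasi-equivalence `v`. -/
lemma comp_comp_eq_of_comp_eq_id {a b c d : HoCat.{u}} {r : a ⟶ b} {q : b ⟶ c} {s : a ⟶ d}
    {v : d ⟶ c} {w : c ⟶ d} (h : r ≫ q = s ≫ v) (h' : v ≫ w = 𝟙 d) : r ≫ q ≫ w = s := by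
  rw [reassoc_of% h, h', Category.comp_id]

lemma id_comp_comp {a b c : HoCat.{u}} {i : a ⟶ a} {q : a ⟶ b} {f g : b ⟶ c} (hi : i = 𝟙 a)
    (h : g = f) : i ≫ q ≫ g = q ≫ f := by
  rw [hi, h, Category.id_comp]

lemma comp_id_comp {a b c : HoCat.{u}} {r : a ⟶ b} {i : b ⟶ b} {f g : b ⟶ c} (hi : i = 𝟙 b)
    (h : f = g) : r ≫ g = r ≫ i ≫ f := by
  rw [hi, h, Category.id_comp]

lemma comp_comp_comp {a b c d e g : HoCat.{u}} {r' : a ⟶ b} {r : b ⟶ c} {r'' : a ⟶ c}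
    {q : c ⟶ d} {f : d ⟶ e} {f' : e ⟶ g} {f'' : d ⟶ g} {q' : b ⟶ e} {q'' : a ⟶ g}
    (hr : r'' = r' ≫ r) (hf : f'' = f ≫ f') (h : r ≫ q ≫ f = q') (h' : r' ≫ q' ≫ f' = q'') :
    r'' ≫ q ≫ f'' = q'' := by
  rw [← h', ← h, hr, hf]
  simp only [Category.assoc]

end HoCat

namespace Hqe

variable {k : Type w} [Field k]

/-- The DG category underlying an object of `Hqe`. -/
def toDGCategory (X : Hqe.{w, u} k) : DGCategory.{w, u} k := X.as.obj

/-- The isomorphism class of functors on homotopy categories induced by a morphism of `Hqe`. -/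
noncomputable def mapH0 {X Y : Hqe.{w, u} k} (f : X ⟶ Y) :
    (h0Functor k).obj X.toDGCategory ⟶ (h0Functor k).obj Y.toDGCategory :=
  (hqeH0Functor k).map f

lemma mapH0_comp {X Y Z : Hqe.{w, u} k} (f : X ⟶ Y) (g : Y ⟶ Z) :
    mapH0 (f ≫ g) = mapH0 f ≫ mapH0 g :=
  (hqeH0Functor k).map_comp f g

lemma mapH0_Q {A B : DGCategory.{w, u} k} (f : A ⟶ B) :
    (mapH0 ((quasiEquivalences k).Q.map f) : (h0Functor k).obj A ⟶ (h0Functor k).obj B) =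
      (h0Functor k).map f :=
  (Functor.congr_hom (Localization.Construction.fac (h0Functor k) (h0Functor_inverts k)) f).trans
    ((Category.id_comp _).trans (Category.comp_id _))

lemma map_comp_mapH0_wInv {A B : DGCategory.{w, u} k} (v : A ⟶ B) (hv : quasiEquivalences k v) :
    (h0Functor k).map v ≫ (mapH0 (Localization.Construction.wInv v hv) :
      (h0Functor k).obj B ⟶ (h0Functor k).obj A) = 𝟙 ((h0Functor k).obj A) := by
  rw [← mapH0_Q]
  exact (mapH0_comp _ _).symm.trans
    ((congrArg mapH0 (Localization.Construction.wIso v hv).hom_inv_id).trans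
      ((hqeH0Functor k).map_id _))

/-- The morphisms `f` of `Hqe` such that for every DG functor `q` to the source of `f`, the
composition of `q` with `f` is represented on homotopy categories by a DG functor defined on some
DG category with a surjective quasi-equivalence to the source of `q`. -/
def liftable (k : Type w) [Field k] : MorphismProperty (Hqe.{w, u} k) := fun X Y f =>
  ∀ (C : DGCategory.{w, u} k) (q : C ⟶ X.toDGCategory), ∃ (D : DGCategory.{w, u} k) (r : D ⟶ C)
    (q' : D ⟶ Y.toDGCategory), DGFunctor.IsSurjectiveQuasiEquivalence r ∧
      (h0Functor k).map r ≫ (h0Functor k).map q ≫ mapH0 f = (h0Functor k).map q'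

/-- The right leg `q'` obtained from `f` is the functor to which the property of `g` is applied.
Quantifying over all `q` in `liftable` makes this possible. -/
instance : (liftable.{w, u} k).IsStableUnderComposition where
  comp_mem {X Y Z} f g hf hg C q := by
    obtain ⟨D, r, q', hr, h⟩ := hf C q
    obtain ⟨D', r', q'', hr', h'⟩ := hg D q'
    exact ⟨D', r' ≫ r, q'', hr'.comp hr,
      HoCat.comp_comp_comp ((h0Functor k).map_comp _ _) (mapH0_comp f g) h h'⟩

lemma liftable_Q {A B : DGCategory.{w, u} k} (f : A ⟶ B) :
    liftable k ((quasiEquivalences k).Q.map f) := fun C (q : C ⟶ A) =>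
  ⟨C, 𝟙 C, q ≫ f, DGFunctor.id_isSurjectiveQuasiEquivalence C,
    (HoCat.id_comp_comp ((h0Functor k).map_id C) (mapH0_Q f)).trans
      ((h0Functor k).map_comp q f).symm⟩

/-- The homotopy pullback of `q` along `v` replaces `q` followed by the inverse of `v`: its square
commutes on `H⁰` up to isomorphism, and there `v` can be cancelled. -/
lemma liftable_wInv {A B : DGCategory.{w, u} k} (v : A ⟶ B) (hv : quasiEquivalences k v) :
    liftable k (Localization.Construction.wInv v hv) := fun C (q : C ⟶ B) => by
  have h : (h0Functor k).map (HoPullback.fstFunctor q v : hoPullback q v ⟶ C) ≫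
      (h0Functor k).map q = (h0Functor k).map (HoPullback.sndFunctor q v : hoPullback q v ⟶ A) ≫
        (h0Functor k).map v := Quotient.sound ⟨HoPullback.mapH0Iso⟩
  exact ⟨hoPullback q v, HoPullback.fstFunctor q v, HoPullback.sndFunctor q v,
    HoPullback.fstFunctor_isSurjectiveQuasiEquivalence q v hv,
    HoCat.comp_comp_eq_of_comp_eq_id h (map_comp_mapH0_wInv v hv)⟩

/-- Every morphism of the localization is a composite of images of DG functors and formal inverses
of quasi-equivalences. -/
lemma liftable_eq_top : liftable.{w, u} k = ⊤ :=
  Localization.Construction.morphismProperty_eq_top _ (fun _ _ f => liftable_Q f)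
    (fun _ _ v hv => liftable_wInv v hv)

/-- A functor represented by a quasi-functor is represented by a roof of DG functors. -/
lemma exists_roof {A B : DGCategory.{w, u} k} (f : QuasiFunctor A B) (G : H0 A ⥤ H0 B)
    (h : f.Represents G) : ∃ (D : DGCategory.{w, u} k) (r : DGFunctor D A) (q : DGFunctor D B),
      r.IsSurjectiveQuasiEquivalence ∧ Nonempty (r.mapH0 ⋙ G ≅ q.mapH0) := by
  have hf : liftable k f := by rw [liftable_eq_top]; trivial
  -- Taking the identity for the test functor yields a roof over `A` itself.
  obtain ⟨D, r, q, hr, h'⟩ := hf A (𝟙 A)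
  have e := (HoCat.comp_id_comp (r := (h0Functor k).map r) ((h0Functor k).map_id A) h).trans h'
  exact ⟨D, r, q, hr, Quotient.exact e⟩

end Hqe

/-! ### Endomorphism algebras and the conclusion -/

/-- A roof of DG functors from a pre-triangulated DG category, inducing an equivalence of homotopy
categories, relates the endomorphism DG algebras of corresponding objects. -/
lemma quasiIsomorphic_endAlgebra_of_roof {k : Type w} [Field k] {A B D : DGCategory.{w, u} k}
    [A.IsPreTriangulated] {r : DGFunctor D A} {q : DGFunctor D B}
    (hr : r.IsSurjectiveQuasiEquivalence) (hq : q.mapH0.IsEquivalence) (c : D.Obj) (b : B.Obj)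
    (i : q.mapH0.obj c ≅ (DGFunctor.id B).mapH0.obj b) :
    DGAlgebra.QuasiIsomorphic (A.endAlgebra (r.obj c)) (B.endAlgebra b) := by
  -- The pullback with the identity of `B` rectifies the isomorphism `i`: the object `P` projects to
  -- `c` and to `b` exactly.
  obtain ⟨P, hP, hP'⟩ := HoPullback.exists_fst_snd_eq c b i
  have hid := DGFunctor.id_isSurjectiveQuasiEquivalence B
  have hid₀ := hid.mapH0_isEquivalence
  have hp := HoPullback.fstFunctor_isSurjectiveQuasiEquivalence q (DGFunctor.id B)
    ⟨hid.map_isQuasiIso, hid₀⟩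
  have hp₀ := hp.mapH0_isEquivalence
  -- Two out of three in the square `mapH0Iso`: the first projection, `q` and the identity all
  -- induce equivalences on `H⁰`.
  have hs : (HoPullback.sndFunctor q (DGFunctor.id B)).mapH0.IsEquivalence := by
    have := Functor.isEquivalence_of_iso (HoPullback.mapH0Iso (F := q) (G := DGFunctor.id B))
    exact Functor.isEquivalence_of_comp_right _ (DGFunctor.id B).mapH0
  have hpr := hp.comp hr
  have e₁ := DGFunctor.isQuasiIso_endAlgebra
    ((HoPullback.fstFunctor q (DGFunctor.id B)).comp r) P (hpr.map_isQuasiIso P P)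
  -- The surjective quasi-equivalence `hpr` onto the pre-triangulated `A` provides the shifts needed
  -- to pass from `H⁰` to all degrees.
  have e₂ := DGFunctor.isQuasiIso_endAlgebra (HoPullback.sndFunctor q (DGFunctor.id B)) P
    (DGFunctor.map_isQuasiIso_of_mapH0 hpr (HoPullback.sndFunctor q (DGFunctor.id B)) P P)
  subst hP hP'
  exact .trans _ _ _ (.symm _ _ (.rel _ _ e₁)) (.rel _ _ e₂)

theorem mainTheorem4 {k : Type w} [Field k] {T : Type u} [Category.{u} T] [Preadditive T]
    [Linear k T] [HasZeroObject T] [HasShift T ℤ] [∀ n : ℤ, (shiftFunctor T n).Additive]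
    [∀ n : ℤ, (shiftFunctor T n).Linear k] [Pretriangulated T] [IsTriangulated T]
    (E₁ E₂ : DGEnhancement k T) (X : T) (B₁ : E₁.B.Obj) (B₂ : E₂.B.Obj)
    (h₁ : Nonempty (X ≅ E₁.e.obj B₁)) (h₂ : Nonempty (X ≅ E₂.e.obj B₂))
    (hT : HasStronglyUniqueDGEnhancement k T) :
    DGAlgebra.QuasiIsomorphic (E₁.B.endAlgebra B₁) (E₂.B.endAlgebra B₂) := by
  obtain ⟨f, G, hG, ⟨hG', -⟩, ⟨η⟩⟩ := hT E₁ E₂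
  obtain ⟨D, r, q, hr, ⟨θ⟩⟩ := Hqe.exists_roof f G hG
  obtain ⟨i₁⟩ := h₁
  obtain ⟨i₂⟩ := h₂
  have he := E₂.isTriangulatedEquivalence.1
  obtain ⟨c, rfl⟩ := hr.obj_surjective B₁
  have hr₀ := hr.mapH0_isEquivalence
  exact quasiIsomorphic_endAlgebra_of_roof hr (Functor.isEquivalence_of_iso θ) c B₂
    -- By `θ`, `q(c)` is isomorphic to `G(r(c))`. Since `E₂.e` is fully faithful, `G(r(c)) ≅ B₂`
    -- follows from the chain `e₂(G(r(c))) ≅ e₁(r(c)) ≅ X ≅ e₂(B₂)` in `T`.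
    (θ.symm.app c ≪≫ E₂.e.preimageIso (η.symm.app _ ≪≫ i₁.symm ≪≫ i₂))
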